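/- For real $x<1$ let $K(x)=\int_0^{\pi/2}\frac{d\theta}{\sqrt{1-x\sin^2\theta}}$ be the complete elliptic integral of the first kind (as a function of the squared modulus), let $\mathrm{Li}_3(z)=\sum_{k\ge 1}z^k/k^3$ for $|z|\le 1$, let $H_n=\sum_{k=1}^n\frac1k$, let $\zeta$ be the Riemann zeta function, and let $G=\sum_{n\ge 0}\frac{(-1)^n}{(2n+1)^2}$ be Catalan's constant. Then $x\mapsto \mathrm{Li}_3(x)K(x)$ is integrable on $(0,1)$, both series below converge, and $$\begin{aligned}\int_0^1 \mathrm{Li}_3(x)K(x)\,dx &= \frac{\pi}{2}\sum_{n\ge 0}\left(\frac{\zeta(3)}{n+1}-\frac{\zeta(2)}{(n+1)^2}+\frac{H_{n+1}}{(n+1)^3}\right)\left[\frac{1}{4^n}\binom{2n}{n}\right]^2\\ &= 2\zeta(3)+\frac{\pi^3}{3}-\frac{4\pi^2}{3}+\frac{\pi}{2}\sum_{n\ge 0}\frac{H_{n+1}}{(n+1)^3}\left[\frac{1}{4^n}\binom{2n}{n}\right]^2\\ &= 64-\frac{4\pi^2}{3}-96\log 2+2\zeta(3)-3\pi^3+64\,G\log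 2-4\pi\log^2 2+128\,\mathrm{Im}\,\mathrm{Li}_3\!\left(\tfrac{1+i}{2}\right).\end{aligned}$$ Moreover, $$\frac{\pi}{2}\sum_{n\ge 0}\frac{H_{n+1}}{(n+1)^3}\left[\frac{1}{4^n}\binom{2n}{n}\right]^2 = 64-\frac{10\pi^3}{3}+128\,\mathrm{Im}\,\mathrm{Li}_3\!\left(\tfrac{1+i}{2}\right)-96\log 2+64\,G\log 2-4\pi\log^2 2.$$ -/

import Mathlib

open scoped Real

noncomputable section

/-- The trilogarithm `Li₃(z) = ∑_{k ≥ 1} z ^ k / k ^ 3`, for a real or complex argument of the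
closed unit disc (where the series converges absolutely). -/
def trilog {𝕜 : Type*} [RCLike 𝕜] (z : 𝕜) : 𝕜 :=
  ∑' n : ℕ, z ^ (n + 1) / ((n : 𝕜) + 1) ^ 3

/-- The complete elliptic integral of the first kind, the argument `x < 1` being the square of the
modulus: `K(x) = ∫_0^{π/2} dθ / √(1 - x sin² θ)`. -/
def ellipticK (x : ℝ) : ℝ :=
  ∫ θ in (0 : ℝ)..(π / 2), 1 / √(1 - x * Real.sin θ ^ 2)

/-- Catalan's constant `∑_{n ≥ 0} (-1) ^ n / (2 n + 1) ^ 2`. -/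
def catalanConstant : ℝ :=
  ∑' n : ℕ, (-1 : ℝ) ^ n / (2 * (n : ℝ) + 1) ^ 2

/-- The real value `ζ(s)` of the Riemann zeta function at an integer `s ≥ 2`. -/
def zetaReal (s : ℕ) : ℝ :=
  (riemannZeta (s : ℂ)).re

/-- The square of the normalized central binomial coefficient, `(C(2n, n) / 4 ^ n) ^ 2`. -/
def centralSq (n : ℕ) : ℝ :=
  ((Nat.choose (2 * n) n : ℝ) / 4 ^ n) ^ 2

end

/-! Write b_n = C(2n, n) / 4^n and c_n = b_n². Expanding 1/√(1 - x sin² θ) by the binomial series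
gives K(x) = (π/2) ∑ c_n x^n, and partial fractions give the moments ∫ x^n Li₃(x) dx. All terms are
nonnegative, so integrating term by term yields the first series
(`hasSum_integral_trilog_mul_ellipticK`).

The ratio c_{n+1}/c_n = 1 - 1/(n+1) + 1/(4(n+1)²) makes n c_n, c_n, H_n c_n and H_n c_n / n
telescope. With the Wallis limit n c_n → 1/π this evaluates ∑ c_n/(n+1) and ∑ c_n/(n+1)², and
reduces ∑ H_{n+1} c_n/(n+1)³ to ∑ H_n c_n/n and ∑ H_{n+1} c_n/(n+1) (`tsum_harmonic_div_cube`).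

In each of these two sums one factor b_n is replaced by the Wallis integral of sin^{2n}. With θ = 2
arctan r one has sin² θ = 4q/(1+q)² for q = r², and at that argument the generating functions with
the remaining factor b_n are explicit: 2 Li₂(q) for H_n/n, and an elementary function for
H_{n+1}/(n+1). What is left is an elementary integral and ∫₀¹ Li₂(r²)/(1+r²) dr.

For the latter, integration by parts leaves arctan r · log(1-r²)/r, the imaginary part of log(1+ir)
(log(1-r) + log(1+r))/r. Polarization turns the products into squares of log((1-r)/(1+ir)),
log((1+ir)/(1+r)) and log(1+ir), up to real terms. Each square has a primitive in Li₃, Li₂ and log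
(`hasDerivAt_arctanLogPrimitive`). The endpoints involve only Li₂(i), Li₃(i) and polylogarithms at
(1 ± i)/2, where Landen's identity removes Li₂. -/

namespace EllipticTrilog

open Filter Topology Set MeasureTheory ComplexConjugate

/-! ### The normalized central binomial coefficients -/

/-- The normalized central binomial coefficient `C(2n, n) / 4 ^ n`. -/
noncomputable def centralCoeff (n : ℕ) : ℝ := (Nat.choose (2 * n) n : ℝ) / 4 ^ n

theorem centralSq_eq (n : ℕ) : centralSq n = centralCoeff n ^ 2 := rfl

theorem centralCoeff_zero : centralCoeff 0 = 1 := by simp [centralCoeff]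

theorem centralCoeff_pos (n : ℕ) : 0 < centralCoeff n := by
  have := Nat.centralBinom_pos n
  rw [Nat.centralBinom_eq_two_mul_choose] at this
  unfold centralCoeff
  positivity

theorem centralCoeff_succ (n : ℕ) :
    centralCoeff (n + 1) = (2 * n + 1) / (2 * n + 2) * centralCoeff n := by
  have h := Nat.succ_mul_centralBinom_succ n
  simp only [Nat.centralBinom_eq_two_mul_choose] at h
  have h' : ((n : ℝ) + 1) * (Nat.choose (2 * (n + 1)) (n + 1) : ℝ)
      = 2 * (2 * n + 1) * (Nat.choose (2 * n) n : ℝ) := by exact_mod_cast h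
  unfold centralCoeff
  rw [pow_succ]
  field_simp
  linear_combination 2 * h'

theorem centralSq_zero : centralSq 0 = 1 := by simp [centralSq]

theorem centralSq_nonneg (n : ℕ) : 0 ≤ centralSq n := sq_nonneg _

theorem centralSq_pos (n : ℕ) : 0 < centralSq n := pow_pos (centralCoeff_pos n) 2

theorem centralSq_succ (n : ℕ) :
    centralSq (n + 1) = ((2 * n + 1) / (2 * n + 2)) ^ 2 * centralSq n := by
  rw [centralSq_eq, centralSq_eq, centralCoeff_succ, mul_pow]

theorem centralSq_le (n : ℕ) : centralSq n ≤ 1 / (2 * n + 1) := by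
  induction n with
  | zero => simp [centralSq_zero]
  | succ n ih =>
    rw [centralSq_succ]
    calc ((2 * n + 1) / (2 * n + 2) : ℝ) ^ 2 * centralSq n
        ≤ ((2 * n + 1) / (2 * n + 2) : ℝ) ^ 2 * (1 / (2 * n + 1)) := by gcongr
      _ ≤ 1 / (2 * ((n + 1 : ℕ) : ℝ) + 1) := by
        push_cast
        rw [div_pow, div_mul_div_comm, div_le_div_iff₀ (by positivity) (by positivity)]
        have : (0 : ℝ) ≤ n := n.cast_nonneg
        nlinarith

theorem centralCoeff_le_one (n : ℕ) : centralCoeff n ≤ 1 := by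
  have h := centralSq_le n
  have h2 : (1 : ℝ) / (2 * n + 1) ≤ 1 := by
    rw [div_le_one (by positivity)]
    have : (0 : ℝ) ≤ n := n.cast_nonneg
    linarith
  rw [centralSq_eq] at h
  exact (sq_le_one_iff₀ (centralCoeff_pos n).le).1 (h.trans h2)

theorem wallis_eq_centralSq (n : ℕ) : Real.Wallis.W n = 1 / (centralSq n * (2 * n + 1)) := by
  induction n with
  | zero => simp [Real.Wallis.W, centralSq_zero]
  | succ n ih =>
    have := centralSq_pos n
    rw [Real.Wallis.W_succ, ih, centralSq_succ]
    push_cast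
    field_simp
    ring

/-- The inverse Wallis product is c_n (2n+1), which tends to 2/π; subtract c_n → 0 and halve. -/
theorem tendsto_mul_centralSq : Tendsto (fun n : ℕ => (n : ℝ) * centralSq n) atTop (𝓝 (1 / π)) := by
  have h := Real.Wallis.tendsto_W_nhds_pi_div_two.inv₀ (by positivity)
  have h3 : Tendsto (fun n : ℕ => centralSq n) atTop (𝓝 0) := by
    refine squeeze_zero centralSq_nonneg (g := fun n : ℕ => 1 / ((n : ℝ) + 1)) (fun n => ?_)
      tendsto_one_div_add_atTop_nhds_zero_nat
    refine (centralSq_le n).trans ?_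
    have : (0 : ℝ) ≤ n := n.cast_nonneg
    gcongr
    linarith
  have h4 := ((h.sub h3).div_const 2)
  have e : ((π / 2)⁻¹ - 0) / 2 = 1 / π := by field_simp; ring
  rw [e] at h4
  refine h4.congr fun n => ?_
  have := centralSq_pos n
  rw [wallis_eq_centralSq]
  field_simp
  ring

/-! ### Harmonic numbers -/

theorem harmonic_nonneg (n : ℕ) : (0 : ℝ) ≤ (harmonic n : ℝ) := by
  rw [harmonic]
  push_cast
  exact Finset.sum_nonneg fun i _ => by positivity

theorem harmonic_cast_succ (n : ℕ) :
    (harmonic (n + 1) : ℝ) = (harmonic n : ℝ) + 1 / ((n : ℝ) + 1) := by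
  rw [harmonic_succ]
  push_cast
  rw [one_div]

/-- A crude substitute for logarithmic growth, by comparison with 2(√(n+1) - √n). Since c_n =
O(1/n), it suffices for every convergence statement about H_n c_n below. -/
theorem harmonic_le_two_mul_sqrt (n : ℕ) : (harmonic n : ℝ) ≤ 2 * √n := by
  induction n with
  | zero => simp
  | succ n ih =>
    rw [harmonic_cast_succ]
    push_cast
    have h0 : (0 : ℝ) ≤ n := n.cast_nonneg
    have h1 := Real.sq_sqrt h0
    have h2 := Real.sq_sqrt (by linarith : (0 : ℝ) ≤ n + 1)
    have h3 := Real.sqrt_nonneg (n : ℝ)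
    have h4 : 0 < √((n : ℝ) + 1) := Real.sqrt_pos.2 (by linarith)
    have h5 : √(n : ℝ) ≤ √((n : ℝ) + 1) := Real.sqrt_le_sqrt (by linarith)
    have h7 : 1 ≤ √((n : ℝ) + 1) := Real.one_le_sqrt.2 (by linarith)
    have h6 : 1 / ((n : ℝ) + 1) ≤ 2 * (√((n : ℝ) + 1) - √(n : ℝ)) := by
      rw [div_le_iff₀ (by linarith)]
      have h8 : (√((n : ℝ) + 1) - √(n : ℝ)) * (√((n : ℝ) + 1) + √(n : ℝ)) = 1 := by nlinarith
      have h9 : √((n : ℝ) + 1) + √(n : ℝ) ≤ 2 * ((n : ℝ) + 1) := by nlinarith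
      nlinarith [mul_le_mul_of_nonneg_left h9 (sub_nonneg.2 h5)]
    linarith

theorem summable_one_div_succ_sq : Summable fun n : ℕ => 1 / ((n : ℝ) + 1) ^ 2 := by
  simpa using (summable_nat_add_iff 1).2 (Real.summable_one_div_nat_pow.2 one_lt_two)

theorem summable_one_div_succ_rpow {p : ℝ} (hp : 1 < p) :
    Summable fun n : ℕ => 1 / ((n : ℝ) + 1) ^ p := by
  simpa using (summable_nat_add_iff 1).2 (Real.summable_one_div_nat_rpow.2 hp)

theorem summable_centralSq_div : Summable fun n : ℕ => centralSq n / ((n : ℝ) + 1) := by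
  refine Summable.of_nonneg_of_le (fun n => div_nonneg (centralSq_nonneg n) (by positivity))
    (fun n => ?_) summable_one_div_succ_sq
  rw [sq, ← div_div]
  have : (0 : ℝ) ≤ n := n.cast_nonneg
  gcongr
  refine (centralSq_le n).trans ?_
  gcongr
  linarith

theorem summable_centralSq_harmonic :
    Summable fun n : ℕ => (harmonic (n + 1) : ℝ) / ((n : ℝ) + 1) * centralSq n := by
  refine Summable.of_nonneg_of_le (fun n => mul_nonneg (div_nonneg (harmonic_nonneg _)
    (by positivity)) (centralSq_nonneg n))
    (fun n => ?_) ((summable_one_div_succ_rpow (p := 3 / 2) (by norm_num)).mul_left 2)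
  have h0 : (0 : ℝ) ≤ n := n.cast_nonneg
  have h1 := harmonic_le_two_mul_sqrt (n + 1)
  have h2 : centralSq n ≤ 1 / ((n : ℝ) + 1) := by
    refine (centralSq_le n).trans ?_
    gcongr
    linarith
  have e : ((n : ℝ) + 1) ^ (3 / 2 : ℝ) = (n + 1) * √((n : ℝ) + 1) := by
    rw [Real.sqrt_eq_rpow, ← Real.rpow_one_add' (by positivity) (by norm_num)]
    norm_num
  push_cast at h1
  have h4 : 0 < √((n : ℝ) + 1) := Real.sqrt_pos.2 (by linarith)
  have h3 := Real.sq_sqrt (by linarith : (0 : ℝ) ≤ n + 1)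
  have h5 := centralSq_nonneg n
  calc _ ≤ 2 * √((n : ℝ) + 1) / (n + 1) * (1 / ((n : ℝ) + 1)) := by gcongr
    _ = _ := by
      rw [e]
      field_simp
      exact h3

theorem summable_centralSq_harmonic_pow (j : ℕ) :
    Summable fun n : ℕ => (harmonic (n + 1) : ℝ) / ((n : ℝ) + 1) ^ (j + 1) * centralSq n := by
  refine summable_centralSq_harmonic.of_nonneg_of_le (fun n => mul_nonneg
    (div_nonneg (harmonic_nonneg _) (by positivity)) (centralSq_nonneg n)) fun n => ?_
  have := centralSq_nonneg n
  have := harmonic_nonneg (n + 1)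
  gcongr
  refine le_self_pow₀ ?_ (by omega)
  linarith [(n.cast_nonneg : (0 : ℝ) ≤ n)]

theorem summable_centralSq_harmonic_div :
    Summable fun n : ℕ => (harmonic n : ℝ) / (n : ℝ) * centralSq n := by
  refine (summable_nat_add_iff 1).1 ?_
  refine summable_centralSq_harmonic.of_nonneg_of_le (fun n => mul_nonneg
    (div_nonneg (harmonic_nonneg _) (by positivity)) (centralSq_nonneg _)) fun n => ?_
  push_cast
  have := harmonic_nonneg (n + 1)
  gcongr
  rw [centralSq_succ]
  refine mul_le_of_le_one_left (centralSq_nonneg n) (pow_le_one₀ (by positivity) ?_)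
  rw [div_le_one (by positivity)]
  linarith

/-! ### Telescoping sums -/

theorem centralSq_succ' (n : ℕ) : centralSq (n + 1)
    = (1 - 1 / ((n : ℝ) + 1) + 1 / 4 / ((n : ℝ) + 1) ^ 2) * centralSq n := by
  rw [centralSq_succ]
  congr 1
  field_simp
  ring

theorem hasSum_of_telescope {f h : ℕ → ℝ} {l : ℝ} (hf : Summable f)
    (e : ∀ n, h (n + 1) - h n = f n) (hl : Tendsto h atTop (𝓝 l)) : HasSum f (l - h 0) := by
  refine (hf.hasSum_iff_tendsto_nat).2 ?_
  have : (fun n => ∑ i ∈ Finset.range n, f i) = fun n => h n - h 0 := by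
    funext n
    rw [← Finset.sum_range_sub]
    exact Finset.sum_congr rfl fun i _ => (e i).symm
  rw [this]
  exact hl.sub_const _

/-- The increment of n c_n is c_n / (4(n+1)), and n c_n → 1/π. -/
theorem hasSum_centralSq_div :
    HasSum (fun n : ℕ => centralSq n / ((n : ℝ) + 1)) (4 / π) := by
  have h := hasSum_of_telescope (f := fun n : ℕ => 1 / 4 * (centralSq n / ((n : ℝ) + 1)))
    (summable_centralSq_div.mul_left _) (fun n => ?_) tendsto_mul_centralSq
  · convert! h.mul_left 4 using 1
    · funext n; ring
    · simp; ring
  · rw [centralSq_succ']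
    push_cast
    field_simp
    ring

theorem tendsto_centralSq : Tendsto centralSq atTop (𝓝 0) := by
  have h := tendsto_mul_centralSq.mul tendsto_one_div_atTop_nhds_zero_nat
  rw [mul_zero] at h
  refine h.congr' ?_
  filter_upwards [eventually_gt_atTop 0] with n hn
  have : (n : ℝ) ≠ 0 := by positivity
  field_simp

theorem hasSum_centralSq_div_sq :
    HasSum (fun n : ℕ => centralSq n / ((n : ℝ) + 1) ^ 2) (16 / π - 4) := by
  have hs : Summable fun n : ℕ => centralSq n / ((n : ℝ) + 1) ^ 2 := by
    refine summable_centralSq_div.of_nonneg_of_le (fun n => div_nonneg (centralSq_nonneg n)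
      (by positivity)) fun n => ?_
    have := centralSq_nonneg n
    gcongr
    exact le_self_pow₀ (by linarith [(n.cast_nonneg : (0 : ℝ) ≤ n)]) two_ne_zero
  have h := hasSum_of_telescope (f := fun n : ℕ => 1 / 4 * (centralSq n / ((n : ℝ) + 1) ^ 2)
    - centralSq n / ((n : ℝ) + 1))
    ((hs.mul_left _).sub summable_centralSq_div) (fun n => ?_) tendsto_centralSq
  · convert! (h.add hasSum_centralSq_div).mul_left 4 using 1
    · funext n; ring
    · rw [centralSq_zero]; ring
  · rw [centralSq_succ']
    ring

theorem tendsto_harmonic_mul_centralSq :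
    Tendsto (fun n : ℕ => (harmonic n : ℝ) * centralSq n) atTop (𝓝 0) := by
  have h := (tendsto_mul_centralSq.mul ((Real.tendsto_sqrt_atTop.comp
    tendsto_natCast_atTop_atTop).inv_tendsto_atTop)).const_mul 2
  rw [mul_zero, mul_zero] at h
  refine squeeze_zero (fun n => mul_nonneg (harmonic_nonneg n) (centralSq_nonneg n))
    (fun n => ?_) h
  have h1 := harmonic_le_two_mul_sqrt n
  have h2 := centralSq_nonneg n
  simp only [Pi.inv_apply, Function.comp_apply]
  calc _ ≤ 2 * √n * centralSq n := by gcongr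
    _ = _ := by
      rcases Nat.eq_zero_or_pos n with rfl | hn
      · simp
      · have h4 : 0 < √(n : ℝ) := Real.sqrt_pos.2 (by positivity)
        have h3 := Real.sq_sqrt (by positivity : (0 : ℝ) ≤ n)
        field_simp
        rw [h3, mul_comm]

theorem tendsto_harmonic_div_mul_centralSq :
    Tendsto (fun n : ℕ => (harmonic n : ℝ) / n * centralSq n) atTop (𝓝 0) :=
  summable_centralSq_harmonic_div.tendsto_atTop_zero

theorem tsum_harmonic_div_sq :
    ∑' n : ℕ, (harmonic (n + 1) : ℝ) / ((n : ℝ) + 1) ^ 2 * centralSq n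
      = 4 * (∑' n : ℕ, (harmonic (n + 1) : ℝ) / ((n : ℝ) + 1) * centralSq n) - 16 / π := by
  have s1 := summable_centralSq_harmonic
  have s2 : Summable fun n : ℕ =>
      (harmonic (n + 1) : ℝ) / ((n : ℝ) + 1) ^ 2 * centralSq n := summable_centralSq_harmonic_pow 1
  have h := hasSum_of_telescope (f := fun n : ℕ => centralSq n / ((n : ℝ) + 1)
    - (harmonic (n + 1) : ℝ) / ((n : ℝ) + 1) * centralSq n
    + 1 / 4 * ((harmonic (n + 1) : ℝ) / ((n : ℝ) + 1) ^ 2 * centralSq n))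
    ((summable_centralSq_div.sub s1).add (s2.mul_left _)) (fun n => ?_)
    tendsto_harmonic_mul_centralSq
  · have h' := (hasSum_centralSq_div.sub s1.hasSum).add (s2.hasSum.mul_left (1 / 4))
    have := h'.unique h
    simp only [harmonic_zero, Rat.cast_zero, zero_mul, sub_zero] at this
    linear_combination 4 * this
  · rw [centralSq_succ', harmonic_cast_succ]
    ring

/-- Telescopes H_n c_n / n, whose value at n = 0 is 0 by the convention 0/0 = 0, then eliminates the
sum with (n+1)² by `tsum_harmonic_div_sq`, which telescopes H_n c_n. -/
theorem tsum_harmonic_div_cube :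
    ∑' n : ℕ, (harmonic (n + 1) : ℝ) / ((n : ℝ) + 1) ^ 3 * centralSq n
      = 4 * (∑' n : ℕ, (harmonic n : ℝ) / n * centralSq n)
        + 12 * (∑' n : ℕ, (harmonic (n + 1) : ℝ) / ((n : ℝ) + 1) * centralSq n) - 64 / π := by
  have s0 := summable_centralSq_harmonic_div
  have s1 := summable_centralSq_harmonic
  have s2 : Summable fun n : ℕ =>
      (harmonic (n + 1) : ℝ) / ((n : ℝ) + 1) ^ 2 * centralSq n := summable_centralSq_harmonic_pow 1
  have s3 : Summable fun n : ℕ =>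
      (harmonic (n + 1) : ℝ) / ((n : ℝ) + 1) ^ 3 * centralSq n := summable_centralSq_harmonic_pow 2
  have h := hasSum_of_telescope (f := fun n : ℕ =>
    (harmonic (n + 1) : ℝ) / ((n : ℝ) + 1) * centralSq n
    - (harmonic (n + 1) : ℝ) / ((n : ℝ) + 1) ^ 2 * centralSq n
    + 1 / 4 * ((harmonic (n + 1) : ℝ) / ((n : ℝ) + 1) ^ 3 * centralSq n)
    - (harmonic n : ℝ) / n * centralSq n)
    (((s1.sub s2).add (s3.mul_left _)).sub s0) (fun n => ?_)
    tendsto_harmonic_div_mul_centralSq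
  · have h' := ((s1.hasSum.sub s2.hasSum).add (s3.hasSum.mul_left (1 / 4))).sub s0.hasSum
    have := h'.unique h
    simp only [harmonic_zero, Rat.cast_zero, zero_mul, sub_zero, zero_div] at this
    linear_combination 4 * this + 4 * tsum_harmonic_div_sq
  · rw [centralSq_succ']
    push_cast
    field_simp

/-! ### Power series in the unit disc -/

section PowerSum

variable {𝕜 : Type*} [RCLike 𝕜]

/-- The sum of the power series with coefficients `u`. -/
noncomputable def powerSum (u : ℕ → 𝕜) (x : 𝕜) : 𝕜 := ∑' n, u n * x ^ n

/-- Linear growth is allowed so that the same results apply to n u_n and (n+1) u_{n+1} when u is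
bounded. -/
theorem summable_powerSum {u : ℕ → 𝕜} {C : ℝ} (hu : ∀ n, ‖u n‖ ≤ C * (n + 1)) {x : 𝕜}
    (hx : ‖x‖ < 1) : Summable fun n => u n * x ^ n := by
  have h1 := summable_pow_mul_geometric_of_norm_lt_one 1 (r := ‖x‖) (by simpa using hx)
  have h0 := summable_geometric_of_lt_one (norm_nonneg x) hx
  refine Summable.of_norm_bounded ((h1.add h0).mul_left C) fun n => ?_
  rw [norm_mul, norm_pow]
  calc _ ≤ C * (n + 1) * ‖x‖ ^ n := by gcongr; exact hu n
    _ = _ := by ring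

theorem powerSum_zero (u : ℕ → 𝕜) : powerSum u 0 = u 0 := by
  rw [powerSum, tsum_eq_single 0 fun n hn => by simp [hn]]
  simp

theorem powerSum_eq_add {u : ℕ → 𝕜} {C : ℝ} (hu : ∀ n, ‖u n‖ ≤ C * (n + 1)) {x : 𝕜}
    (hx : ‖x‖ < 1) : powerSum u x = u 0 + x * powerSum (fun n => u (n + 1)) x := by
  rw [powerSum, (summable_powerSum hu hx).tsum_eq_zero_add, powerSum, ← tsum_mul_left]
  simp only [pow_zero, mul_one]
  congr 1
  exact tsum_congr fun n => by ring

theorem hasDerivAt_powerSum {u : ℕ → 𝕜} {C : ℝ} (hu : ∀ n, ‖u n‖ ≤ C * (n + 1)) {x : 𝕜}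
    (hx : ‖x‖ < 1) :
    HasDerivAt (powerSum u) (powerSum (fun n => ((n : 𝕜) + 1) * u (n + 1)) x) x := by
  -- Termwise differentiation needs a uniform summable bound, available on the ball of an
  -- intermediate radius ρ < 1.
  obtain ⟨ρ, hρ, hρ1⟩ := exists_between hx
  have hρ0 : 0 ≤ ρ := (norm_nonneg x).trans hρ.le
  have hC : 0 ≤ C := by simpa using (norm_nonneg _).trans (hu 0)
  have hs : Summable fun n : ℕ => C * (n + 1) * (n * ρ ^ (n - 1)) := by
    refine (summable_nat_add_iff 1).1 ?_
    have h2 := summable_pow_mul_geometric_of_norm_lt_one 2 (r := ρ)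
      (by rwa [Real.norm_of_nonneg hρ0])
    have h1 := summable_pow_mul_geometric_of_norm_lt_one 1 (r := ρ)
      (by rwa [Real.norm_of_nonneg hρ0])
    have h0 := summable_geometric_of_lt_one hρ0 hρ1
    refine (((h2.add (h1.mul_left 3)).add (h0.mul_left 2)).mul_left C).congr fun n => ?_
    push_cast
    ring
  have hb : ∀ n : ℕ, ∀ y ∈ Metric.ball (0 : 𝕜) ρ,
      ‖u n * ((n : 𝕜) * y ^ (n - 1))‖ ≤ C * (n + 1) * (n * ρ ^ (n - 1)) := fun n y hy => by
    rw [norm_mul, norm_mul, norm_pow, RCLike.norm_natCast]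
    have hy' : ‖y‖ ≤ ρ := (mem_ball_zero_iff.1 hy).le
    have := hu n
    gcongr
  have hmem : x ∈ Metric.ball (0 : 𝕜) ρ := by simpa using hρ
  have h := hasDerivAt_tsum_of_isPreconnected (g := fun n z => u n * z ^ n)
    (g' := fun n z => u n * ((n : 𝕜) * z ^ (n - 1))) (y₀ := x) (y := x) hs Metric.isOpen_ball
    (convex_ball _ _).isPreconnected (fun n y _ => (hasDerivAt_pow n y).const_mul (u n)) hb hmem
    (summable_powerSum hu hx) hmem
  have hs' : Summable fun n : ℕ => u n * ((n : 𝕜) * x ^ (n - 1)) :=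
    Summable.of_norm_bounded hs fun n => hb n x hmem
  have e : ∑' n : ℕ, u n * ((n : 𝕜) * x ^ (n - 1))
      = powerSum (fun n => ((n : 𝕜) + 1) * u (n + 1)) x := by
    rw [hs'.tsum_eq_zero_add, powerSum]
    simp only [Nat.cast_zero, zero_mul, mul_zero, zero_add, Nat.add_sub_cancel]
    exact tsum_congr fun n => by push_cast; ring
  rwa [e] at h

/-- The polylogarithm series `∑_{n ≥ 1} z ^ n / n ^ k`. -/
noncomputable def polylog (k : ℕ) (z : 𝕜) : 𝕜 := ∑' n : ℕ, z ^ (n + 1) / ((n : 𝕜) + 1) ^ k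

theorem trilog_eq_polylog (z : 𝕜) : trilog z = polylog 3 z := rfl

theorem polylog_zero (k : ℕ) : polylog k (0 : 𝕜) = 0 := by simp [polylog]

theorem polylog_eq_powerSum (k : ℕ) {z : 𝕜} (hz : ‖z‖ < 1) :
    polylog (k + 1) z = powerSum (fun n => 1 / (n : 𝕜) ^ (k + 1)) z := by
  have hu : ∀ n : ℕ, ‖1 / (n : 𝕜) ^ (k + 1)‖ ≤ 1 * (n + 1) := fun n => by
    rcases Nat.eq_zero_or_pos n with rfl | hn
    · simp
    · rw [norm_div, norm_one, norm_pow, RCLike.norm_natCast, one_mul]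
      have : (1 : ℝ) ≤ n := by exact_mod_cast hn
      exact (div_le_one_of_le₀ (one_le_pow₀ this) (by positivity)).trans (by linarith)
  rw [powerSum_eq_add hu hz, powerSum, ← tsum_mul_left, polylog]
  simp only [Nat.cast_zero, ne_eq, Nat.succ_ne_zero, not_false_eq_true, zero_pow, div_zero, zero_add]
  exact tsum_congr fun n => by push_cast; ring

theorem hasDerivAt_polylog (k : ℕ) {z : 𝕜} (hz : ‖z‖ < 1) (h0 : z ≠ 0) :
    HasDerivAt (polylog (k + 1)) (polylog k z / z) z := by
  have hu : ∀ n : ℕ, ‖1 / (n : 𝕜) ^ (k + 1)‖ ≤ 1 * (n + 1) := fun n => by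
    rcases Nat.eq_zero_or_pos n with rfl | hn
    · simp
    · rw [norm_div, norm_one, norm_pow, RCLike.norm_natCast, one_mul]
      have : (1 : ℝ) ≤ n := by exact_mod_cast hn
      exact (div_le_one_of_le₀ (one_le_pow₀ this) (by positivity)).trans (by linarith)
  have h := hasDerivAt_powerSum hu hz
  have e : powerSum (fun n : ℕ => ((n : 𝕜) + 1) * (1 / ((n + 1 : ℕ) : 𝕜) ^ (k + 1))) z
      = polylog k z / z := by
    rw [eq_div_iff h0, powerSum, ← tsum_mul_right, polylog]
    refine tsum_congr fun n => ?_
    have : (n : 𝕜) + 1 ≠ 0 := by exact_mod_cast n.succ_ne_zero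
    push_cast
    field_simp
    ring
  rw [e] at h
  refine h.congr_of_eventuallyEq ?_
  filter_upwards [Metric.isOpen_ball.mem_nhds (by simpa using hz : z ∈ Metric.ball (0 : 𝕜) 1)]
    with y hy
  exact polylog_eq_powerSum k (by simpa using hy)

theorem norm_polylog_term_le (k n : ℕ) {z : 𝕜} (hz : ‖z‖ ≤ 1) :
    ‖z ^ (n + 1) / ((n : 𝕜) + 1) ^ (k + 2)‖ ≤ 1 / ((n : ℝ) + 1) ^ 2 := by
  have e : ‖(n : 𝕜) + 1‖ = (n : ℝ) + 1 := by
    have := RCLike.norm_natCast (K := 𝕜) (n + 1)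
    push_cast at this
    exact this
  rw [norm_div, norm_pow, norm_pow, e]
  have h1 : (1 : ℝ) ≤ (n : ℝ) + 1 := by linarith [(n.cast_nonneg : (0 : ℝ) ≤ n)]
  gcongr
  · exact pow_le_one₀ (norm_nonneg z) hz
  · omega

theorem summable_polylog (k : ℕ) {z : 𝕜} (hz : ‖z‖ ≤ 1) :
    Summable fun n : ℕ => z ^ (n + 1) / ((n : 𝕜) + 1) ^ (k + 2) :=
  Summable.of_norm_bounded summable_one_div_succ_sq fun n => norm_polylog_term_le k n hz

theorem continuousOn_polylog (k : ℕ) :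
    ContinuousOn (polylog (k + 2) : 𝕜 → 𝕜) (Metric.closedBall 0 1) :=
  continuousOn_tsum (fun n => by fun_prop) summable_one_div_succ_sq
    fun n z hz => norm_polylog_term_le k n (by simpa using hz)

end PowerSum

theorem polylog_one_real {x : ℝ} (hx : |x| < 1) : polylog 1 x = -Real.log (1 - x) := by
  have h := (Real.hasSum_pow_div_log_of_abs_lt_one hx).tsum_eq
  simpa [polylog] using h

theorem polylog_one_complex {z : ℂ} (hz : ‖z‖ < 1) : polylog 1 z = -Complex.log (1 - z) := by
  have h := Complex.hasSum_taylorSeries_neg_log hz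
  have h1 := h.summable.tsum_eq_zero_add
  rw [h.tsum_eq] at h1
  rw [h1]
  simp [polylog]

/-- Derivatives are only compared in the open interval because the closed forms below may divide by
the variable, which vanishes at 0. -/
theorem eq_of_hasDerivAt_eq {f g f' : ℝ → ℝ} {b : ℝ} (hb : 0 ≤ b)
    (hf : ContinuousOn f (Icc 0 b)) (hg : ContinuousOn g (Icc 0 b))
    (hf' : ∀ x ∈ Ioo 0 b, HasDerivAt f (f' x) x) (hg' : ∀ x ∈ Ioo 0 b, HasDerivAt g (f' x) x)
    (h0 : f 0 = g 0) : f b = g b := by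
  rcases hb.eq_or_lt with rfl | hb
  · exact h0
  · obtain ⟨c, -, hc⟩ := exists_hasDerivAt_eq_slope (f - g) (fun _ => 0) hb (hf.sub hg)
      fun x hx => by simpa using (hf' x hx).sub (hg' x hx)
    have hb' : b - 0 ≠ 0 := by linarith
    field_simp at hc
    simp only [Pi.sub_apply, zero_mul] at hc
    linarith

/-! ### Generating functions in the variable `q`, with `a = 4 q / (1 + q) ^ 2` -/

/-- The substitution `a = 4 q / (1 + q) ^ 2`. -/
noncomputable def landen (q : ℝ) : ℝ := 4 * q / (1 + q) ^ 2

theorem landen_zero : landen 0 = 0 := by simp [landen]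

theorem one_sub_landen {q : ℝ} (hq : 0 ≤ q) : 1 - landen q = ((1 - q) / (1 + q)) ^ 2 := by
  have : 1 + q ≠ 0 := by linarith
  unfold landen
  field_simp
  ring

theorem landen_nonneg {q : ℝ} (hq : 0 ≤ q) : 0 ≤ landen q := by
  unfold landen
  positivity

theorem norm_landen_lt_one {q : ℝ} (hq : q ∈ Ico (0 : ℝ) 1) : ‖landen q‖ < 1 := by
  rw [Real.norm_of_nonneg (landen_nonneg hq.1)]
  have h := one_sub_landen hq.1
  have : 0 < (1 - q) / (1 + q) := div_pos (by linarith [hq.2]) (by linarith [hq.1])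
  have := pow_pos this 2
  linarith

theorem hasDerivAt_landen {q : ℝ} (hq : 0 ≤ q) :
    HasDerivAt landen (4 * (1 - q) / (1 + q) ^ 3) q := by
  have h1 : 1 + q ≠ 0 := by linarith
  have h := ((hasDerivAt_id q).const_mul 4).div
    (((hasDerivAt_id q).const_add 1).pow 2) (pow_ne_zero 2 h1)
  convert! h using 1
  simp only [id, Pi.pow_apply]
  field_simp
  ring

theorem hasDerivAt_powerSum_landen {u : ℕ → ℝ} {C : ℝ} (hu : ∀ n, ‖u n‖ ≤ C * (n + 1)) {q : ℝ}
    (hq : q ∈ Ico (0 : ℝ) 1) :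
    HasDerivAt (fun q => powerSum u (landen q))
      (powerSum (fun n => ((n : ℝ) + 1) * u (n + 1)) (landen q) * (4 * (1 - q) / (1 + q) ^ 3)) q :=
  (hasDerivAt_powerSum hu (norm_landen_lt_one hq)).comp q (hasDerivAt_landen hq.1)

theorem norm_le_mul_succ {u : ℕ → ℝ} {C : ℝ} (hu : ∀ n, ‖u n‖ ≤ C) (n : ℕ) :
    ‖u n‖ ≤ C * (n + 1) := by
  have hC : 0 ≤ C := (norm_nonneg _).trans (hu 0)
  exact (hu n).trans (le_mul_of_one_le_right hC (by linarith [(n.cast_nonneg : (0 : ℝ) ≤ n)]))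

theorem norm_natCast_mul_le {u : ℕ → ℝ} {C : ℝ} (hu : ∀ n, ‖u n‖ ≤ C) (n : ℕ) :
    ‖(n : ℝ) * u n‖ ≤ C * (n + 1) := by
  have hC : 0 ≤ C := (norm_nonneg _).trans (hu 0)
  rw [norm_mul, RCLike.norm_natCast]
  have := mul_le_mul_of_nonneg_left (hu n) (n.cast_nonneg : (0 : ℝ) ≤ n)
  linarith

theorem norm_succ_mul_le {u : ℕ → ℝ} {C : ℝ} (hu : ∀ n, ‖u n‖ ≤ C) (n : ℕ) :
    ‖((n : ℝ) + 1) * u (n + 1)‖ ≤ C * (n + 1) := by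
  rw [norm_mul, Real.norm_of_nonneg (by positivity), mul_comm]
  gcongr
  exact hu _

theorem one_sub_mul_powerSum_deriv {u : ℕ → ℝ} {C : ℝ} (hu : ∀ n, ‖u n‖ ≤ C) {a : ℝ}
    (ha : ‖a‖ < 1) :
    (1 - a) * powerSum (fun n => ((n : ℝ) + 1) * u (n + 1)) a
      = powerSum (fun n => ((n : ℝ) + 1) * u (n + 1) - n * u n) a := by
  have s1 := summable_powerSum (norm_succ_mul_le hu) ha
  have s2 := summable_powerSum (norm_natCast_mul_le hu) ha
  have e := powerSum_eq_add (norm_natCast_mul_le hu) ha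
  simp only [Nat.cast_zero, zero_mul, zero_add, Nat.cast_add, Nat.cast_one] at e
  rw [sub_mul, one_mul, ← e, powerSum, powerSum, powerSum, ← s1.tsum_sub s2]
  exact tsum_congr fun n => by ring

/-- The recurrence says (1-a) U' = U/2 + W for the generating functions U and W. The integrating
factor is √(1-a), which equals (1-q)/(1+q) after the substitution. -/
theorem hasDerivAt_powerSum_landen_mul {u w : ℕ → ℝ} {C D : ℝ} (hu : ∀ n, ‖u n‖ ≤ C)
    (hw : ∀ n, ‖w n‖ ≤ D)
    (huw : ∀ n : ℕ, ((n : ℝ) + 1) * u (n + 1) - n * u n = u n / 2 + w n) {q : ℝ}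
    (hq : q ∈ Ico (0 : ℝ) 1) :
    HasDerivAt (fun q => powerSum u (landen q) * ((1 - q) / (1 + q)))
      (4 * powerSum w (landen q) / (1 + q) ^ 2) q := by
  have ha := norm_landen_lt_one hq
  have h1 : 1 + q ≠ 0 := by linarith [hq.1]
  have s1 := summable_powerSum (norm_le_mul_succ hu) ha
  have s2 := summable_powerSum (norm_le_mul_succ hw) ha
  have e := one_sub_mul_powerSum_deriv hu ha
  have e2 : powerSum (fun n : ℕ => ((n : ℝ) + 1) * u (n + 1) - n * u n) (landen q)
      = powerSum u (landen q) / 2 + powerSum w (landen q) := by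
    simp only [huw, powerSum]
    rw [← tsum_div_const, ← (s1.div_const 2).tsum_add s2]
    exact tsum_congr fun n => by ring
  rw [e2, one_sub_landen hq.1] at e
  have h := (hasDerivAt_powerSum_landen (norm_le_mul_succ hu) hq).mul
    (((hasDerivAt_id q).const_sub 1).div ((hasDerivAt_id q).const_add 1) h1)
  convert! h using 1
  simp only [id, Pi.div_apply]
  field_simp at e ⊢
  linear_combination (-2 : ℝ) * e

theorem continuousOn_of_forall_hasDerivAt {f f' : ℝ → ℝ} {b : ℝ} (hb : b < 1)
    (h : ∀ q ∈ Ico (0 : ℝ) 1, HasDerivAt f (f' q) q) : ContinuousOn f (Icc 0 b) :=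
  fun q hq => (h q ⟨hq.1, hq.2.trans_lt hb⟩).continuousAt.continuousWithinAt

theorem norm_centralCoeff_le (n : ℕ) : ‖centralCoeff n‖ ≤ 1 := by
  rw [Real.norm_of_nonneg (centralCoeff_pos n).le]
  exact centralCoeff_le_one n

theorem powerSum_centralCoeff_landen {q : ℝ} (hq : q ∈ Ico (0 : ℝ) 1) :
    powerSum centralCoeff (landen q) = (1 + q) / (1 - q) := by
  have hd : ∀ q ∈ Ico (0 : ℝ) 1, HasDerivAt
      (fun q => powerSum centralCoeff (landen q) * ((1 - q) / (1 + q))) 0 q := fun q hq => by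
    have h := hasDerivAt_powerSum_landen_mul norm_centralCoeff_le (w := fun _ => 0) (D := 0)
      (by simp) (fun n => by rw [centralCoeff_succ]; field_simp; ring) hq
    simpa [powerSum] using h
  have h := eq_of_hasDerivAt_eq hq.1 (continuousOn_of_forall_hasDerivAt hq.2 hd)
    (continuousOn_const (c := 1)) (fun x hx => hd x ⟨hx.1.le, hx.2.trans hq.2⟩)
    (fun x _ => hasDerivAt_const x 1)
    (by simp [landen_zero, powerSum_zero, centralCoeff_zero])
  have h1 : 1 + q ≠ 0 := by linarith [hq.1]
  have h2 : 1 - q ≠ 0 := by linarith [hq.2]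
  field_simp at h ⊢
  exact h

theorem powerSum_centralCoeff_succ_landen {q : ℝ} (hq : q ∈ Ioo (0 : ℝ) 1) :
    powerSum (fun n => centralCoeff (n + 1)) (landen q) = (1 + q) ^ 2 / (2 * (1 - q)) := by
  have h := powerSum_eq_add (norm_le_mul_succ norm_centralCoeff_le)
    (norm_landen_lt_one ⟨hq.1.le, hq.2⟩)
  rw [powerSum_centralCoeff_landen ⟨hq.1.le, hq.2⟩, centralCoeff_zero, landen] at h
  have h0 : q ≠ 0 := hq.1.ne'
  have h1 : 1 + q ≠ 0 := by linarith [hq.1]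
  have h2 : 1 - q ≠ 0 := by linarith [hq.2]
  rw [landen]
  generalize powerSum (𝕜 := ℝ) _ _ = s at h ⊢
  field_simp at h ⊢
  refine mul_left_cancel₀ h0 ?_
  linear_combination (-1 / 2 : ℝ) * h

/-- The growth of H_n is absorbed by b_n: b_n² ≤ 1/(2n+1) and H_n² ≤ 4n. -/
theorem norm_centralCoeff_mul_harmonic_le (n : ℕ) : ‖centralCoeff n * (harmonic n : ℝ)‖ ≤ 2 := by
  have hb := centralCoeff_pos n
  have hh := harmonic_nonneg n
  rw [Real.norm_of_nonneg (mul_nonneg hb.le hh)]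
  refine abs_le_of_sq_le_sq' ?_ (by norm_num) |>.2
  have h1 := harmonic_le_two_mul_sqrt n
  have h2 := centralSq_le n
  have h0 : (0 : ℝ) ≤ n := n.cast_nonneg
  rw [centralSq_eq] at h2
  rw [mul_pow]
  calc _ ≤ (1 / (2 * n + 1) : ℝ) * (2 * √n) ^ 2 := by gcongr
    _ = 4 * n / (2 * n + 1) := by rw [mul_pow, Real.sq_sqrt h0]; ring
    _ ≤ 2 ^ 2 := by
      rw [div_le_iff₀ (by positivity)]
      linarith

/-- The sequence u_n = b_n H_n satisfies the recurrence of `hasDerivAt_powerSum_landen_mul` with w_n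
= b_{n+1}, whose generating function is already known. -/
theorem powerSum_centralCoeff_mul_harmonic_landen {q : ℝ} (hq : q ∈ Ico (0 : ℝ) 1) :
    powerSum (fun n => centralCoeff n * (harmonic n : ℝ)) (landen q)
      = -2 * (1 + q) / (1 - q) * Real.log (1 - q) := by
  have hd := fun q (hq : q ∈ Ico (0 : ℝ) 1) =>
    hasDerivAt_powerSum_landen_mul norm_centralCoeff_mul_harmonic_le
      (w := fun n => centralCoeff (n + 1)) (fun n => norm_centralCoeff_le (n + 1)) (fun n => by
        rw [harmonic_cast_succ, centralCoeff_succ]; field_simp; ring) hq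
  have hlog : ∀ q < (1 : ℝ), HasDerivAt (fun q => -2 * Real.log (1 - q)) (2 / (1 - q)) q :=
    fun q hq => by
      have h2 : 1 - q ≠ 0 := by linarith
      convert! (((hasDerivAt_id q).const_sub 1).log h2).const_mul (-2) using 1
      simp only [id]
      ring
  have h := eq_of_hasDerivAt_eq hq.1 (continuousOn_of_forall_hasDerivAt hq.2 hd)
    (continuousOn_of_forall_hasDerivAt hq.2 fun q hq => hlog q hq.2)
    (fun x hx => hd x ⟨hx.1.le, hx.2.trans hq.2⟩)
    (fun x hx => by
      convert! hlog x (hx.2.trans hq.2) using 1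
      rw [powerSum_centralCoeff_succ_landen ⟨hx.1, hx.2.trans hq.2⟩]
      have h1 : 1 + x ≠ 0 := by linarith [hx.1]
      have h2 : 1 - x ≠ 0 := by linarith [hx.2, hq.2]
      field_simp
      norm_num)
    (by simp [landen_zero, powerSum_zero])
  have h1 : 1 + q ≠ 0 := by linarith [hq.1]
  have h2 : 1 - q ≠ 0 := by linarith [hq.2]
  field_simp at h ⊢
  linarith

theorem norm_le_of_mul_natCast {u v : ℕ → ℝ} {C : ℝ} (hu : ∀ n, ‖u n‖ ≤ C) (h0 : v 0 = 0)
    (h : ∀ n : ℕ, ((n : ℝ) + 1) * v (n + 1) = u (n + 1)) (n : ℕ) : ‖v n‖ ≤ C * (n + 1) := by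
  refine norm_le_mul_succ (fun n => ?_) n
  rcases n with _ | n
  · rw [h0, norm_zero]
    exact (norm_nonneg _).trans (hu 0)
  · have h1 : (1 : ℝ) ≤ (n : ℝ) + 1 := by linarith [(n.cast_nonneg : (0 : ℝ) ≤ n)]
    refine le_trans ?_ (hu (n + 1))
    rw [← h n, norm_mul, Real.norm_of_nonneg (by linarith : (0 : ℝ) ≤ (n : ℝ) + 1)]
    exact le_mul_of_one_le_left (norm_nonneg _) h1

theorem hasDerivAt_polylog_two {q : ℝ} (hq : q ∈ Ioo (0 : ℝ) 1) :
    HasDerivAt (polylog 2 : ℝ → ℝ) (-Real.log (1 - q) / q) q := by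
  have hq' : |q| < 1 := by rw [abs_of_pos hq.1]; exact hq.2
  have h := hasDerivAt_polylog 1 (z := q) hq' hq.1.ne'
  rwa [polylog_one_real hq'] at h

/-- If U is the left side as a function of a, then a U'(a) = ∑ b_n H_n a^n. Multiplying by a'/a =
(1-q)/(q(1+q)) leaves -2 log(1-q)/q, the derivative of 2 Li₂(q). The coefficient at n = 0 is 0 since
0/0 = 0. -/
theorem powerSum_dilog_landen {q : ℝ} (hq : q ∈ Ico (0 : ℝ) 1) :
    powerSum (fun n => centralCoeff n * ((harmonic n : ℝ) / n)) (landen q) = 2 * polylog 2 q := by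
  have hu := norm_le_of_mul_natCast norm_centralCoeff_mul_harmonic_le
    (v := fun n => centralCoeff n * ((harmonic n : ℝ) / n)) (by simp)
    (fun n => by push_cast; field_simp)
  have hd := fun q (hq : q ∈ Ico (0 : ℝ) 1) => hasDerivAt_powerSum_landen hu hq
  refine eq_of_hasDerivAt_eq (g := fun q => 2 * polylog 2 q) hq.1
    (continuousOn_of_forall_hasDerivAt hq.2 hd) ?_
    (fun x hx => hd x ⟨hx.1.le, hx.2.trans hq.2⟩) (fun x hx => ?_)
    (by simp [landen_zero, powerSum_zero, polylog_zero])
  · refine continuousOn_const.mul ((continuousOn_polylog (𝕜 := ℝ) 0).mono fun x hx => ?_)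
    rw [mem_closedBall_zero_iff, Real.norm_of_nonneg hx.1]
    exact hx.2.trans hq.2.le
  · have hx' : x ∈ Ico (0 : ℝ) 1 := ⟨hx.1.le, hx.2.trans hq.2⟩
    convert! (hasDerivAt_polylog_two ⟨hx.1, hx'.2⟩).const_mul 2 using 1
    have e := powerSum_eq_add (norm_le_mul_succ norm_centralCoeff_mul_harmonic_le)
      (norm_landen_lt_one hx')
    rw [powerSum_centralCoeff_mul_harmonic_landen hx'] at e
    have e2 : (fun n : ℕ => ((n : ℝ) + 1) * (centralCoeff (n + 1) *
        ((harmonic (n + 1) : ℝ) / (n + 1 : ℕ)))) =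
        fun n => centralCoeff (n + 1) * (harmonic (n + 1) : ℝ) := by
      funext n
      push_cast
      field_simp
    rw [e2]
    simp only [harmonic_zero, Rat.cast_zero, mul_zero, zero_add] at e
    have h0 : x ≠ 0 := hx.1.ne'
    have h1 : 1 + x ≠ 0 := by linarith [hx.1]
    have h2 : 1 - x ≠ 0 := by linarith [hx'.2]
    rw [landen] at e ⊢
    generalize powerSum (𝕜 := ℝ) _ _ = s at e ⊢
    field_simp at e ⊢
    linarith

theorem centralCoeff_div_succ (n : ℕ) :
    centralCoeff n / ((n : ℝ) + 1) = 2 * (centralCoeff n - centralCoeff (n + 1)) := by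
  rw [centralCoeff_succ]
  field_simp
  ring

theorem norm_centralCoeff_mul_harmonic_succ_le (n : ℕ) :
    ‖centralCoeff n * (harmonic (n + 1) : ℝ)‖ ≤ 3 := by
  rw [harmonic_cast_succ, mul_add]
  refine (norm_add_le_of_le (norm_centralCoeff_mul_harmonic_le n) (?_ : _ ≤ (1 : ℝ))).trans
    (by norm_num)
  have h1 := centralCoeff_pos n
  rw [Real.norm_of_nonneg (by positivity)]
  refine mul_le_one₀ (centralCoeff_le_one n) (by positivity) ?_
  rw [div_le_one (by positivity)]
  linarith [(n.cast_nonneg : (0 : ℝ) ≤ n)]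

theorem powerSum_centralCoeff_mul_harmonic_succ_landen {q : ℝ} (hq : q ∈ Ioo (0 : ℝ) 1) :
    powerSum (fun n => centralCoeff n * (harmonic (n + 1) : ℝ)) (landen q)
      = -2 * (1 + q) / (1 - q) * Real.log (1 - q) + (1 + q) := by
  have hq' : q ∈ Ico (0 : ℝ) 1 := ⟨hq.1.le, hq.2⟩
  have ha := norm_landen_lt_one hq'
  have s0 := summable_powerSum (norm_le_mul_succ norm_centralCoeff_mul_harmonic_le) ha
  have s1 := summable_powerSum (norm_le_mul_succ norm_centralCoeff_le) ha
  have s2 := summable_powerSum (norm_le_mul_succ fun n => norm_centralCoeff_le (n + 1)) ha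
  have e : powerSum (fun n => centralCoeff n * (harmonic (n + 1) : ℝ)) (landen q)
      = powerSum (fun n => centralCoeff n * (harmonic n : ℝ)) (landen q)
        + 2 * (powerSum centralCoeff (landen q)
          - powerSum (fun n => centralCoeff (n + 1)) (landen q)) := by
    simp only [powerSum]
    rw [← s1.tsum_sub s2, ← tsum_mul_left, ← s0.tsum_add ((s1.sub s2).mul_left 2)]
    refine tsum_congr fun n => ?_
    rw [harmonic_cast_succ]
    linear_combination landen q ^ n * centralCoeff_div_succ n
  rw [e, powerSum_centralCoeff_mul_harmonic_landen hq', powerSum_centralCoeff_landen hq',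
    powerSum_centralCoeff_succ_landen hq]
  have h2 : 1 - q ≠ 0 := by linarith [hq.2]
  field_simp
  ring

theorem powerSum_harmonic_div_landen {q : ℝ} (hq : q ∈ Ioo (0 : ℝ) 1) :
    powerSum (fun n => centralCoeff n * ((harmonic (n + 1) : ℝ) / ((n : ℝ) + 1))) (landen q)
      = 2 * (1 + q) + (1 - q ^ 2) / q * Real.log (1 - q) := by
  -- The shifted coefficients v_n = b_{n-1} H_n / n generate a times the wanted series, and their
  -- derivative series is ∑ b_n H_{n+1} a^n. The truncated index at n = 0 is harmless because v_0 =
  -- 0.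
  have hu := norm_le_of_mul_natCast (u := fun n => centralCoeff (n - 1) * (harmonic (n - 1 + 1) : ℝ))
    (fun n => norm_centralCoeff_mul_harmonic_succ_le (n - 1))
    (v := fun n => centralCoeff (n - 1) * ((harmonic n : ℝ) / n)) (by simp)
    (fun n => by push_cast; field_simp)
  have hd := fun q (hq : q ∈ Ico (0 : ℝ) 1) => hasDerivAt_powerSum_landen hu hq
  -- This function is `landen q` times the claimed closed form.
  have hg : ∀ x ∈ Ico (0 : ℝ) 1,
      HasDerivAt (fun q => 8 * q / (1 + q) + 4 * ((1 - q) / (1 + q)) * Real.log (1 - q))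
        ((-2 * (1 + x) / (1 - x) * Real.log (1 - x) + (1 + x)) * (4 * (1 - x) / (1 + x) ^ 3)) x :=
    fun x hx => by
      have h1 : 1 + x ≠ 0 := by linarith [hx.1]
      have h2 : 1 - x ≠ 0 := by linarith [hx.2]
      have d1 := (hasDerivAt_id x).const_add 1
      have d2 := (hasDerivAt_id x).const_sub 1
      convert! (((hasDerivAt_id x).const_mul 8).div d1 h1).add
        (((d2.div d1 h1).const_mul 4).mul (d2.log h2)) using 1
      simp only [id, Pi.div_apply]
      field_simp
      ring
  have h := eq_of_hasDerivAt_eq hq.1.le (continuousOn_of_forall_hasDerivAt hq.2 hd)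
    (continuousOn_of_forall_hasDerivAt hq.2 hg)
    (fun x hx => hd x ⟨hx.1.le, hx.2.trans hq.2⟩) (fun x hx => by
      have hx' : x ∈ Ioo (0 : ℝ) 1 := ⟨hx.1, hx.2.trans hq.2⟩
      convert! hg x ⟨hx'.1.le, hx'.2⟩ using 2
      rw [← powerSum_centralCoeff_mul_harmonic_succ_landen hx']
      congr 1
      funext n
      push_cast
      field_simp)
    (by simp [landen_zero, powerSum_zero])
  rw [powerSum_eq_add hu (norm_landen_lt_one ⟨hq.1.le, hq.2⟩)] at h
  simp only [harmonic_zero, Rat.cast_zero, zero_div, mul_zero, zero_add, Nat.add_sub_cancel,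
    Nat.cast_add, Nat.cast_one] at h
  have h0 : q ≠ 0 := hq.1.ne'
  have h1 : 1 + q ≠ 0 := by linarith [hq.1]
  have h2 : 1 - q ≠ 0 := by linarith [hq.2]
  rw [landen] at h ⊢
  generalize powerSum (𝕜 := ℝ) _ _ = s at h ⊢
  field_simp at h ⊢
  linarith

/-! ### Moments and termwise integration -/

theorem integral_sin_pow_even_half (n : ℕ) :
    ∫ θ in (0 : ℝ)..(π / 2), Real.sin θ ^ (2 * n) = π / 2 * centralCoeff n := by
  induction n with
  | zero => simp [centralCoeff_zero]
  | succ n ih =>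
    rw [mul_add, mul_one, integral_sin_pow, ih, centralCoeff_succ]
    simp
    ring

theorem sin_two_mul_arctan (r : ℝ) : Real.sin (2 * Real.arctan r) = 2 * r / (1 + r ^ 2) := by
  have h : 0 < 1 + r ^ 2 := by positivity
  rw [Real.sin_two_mul, Real.sin_arctan, Real.cos_arctan, mul_assoc, div_mul_div_comm,
    Real.mul_self_sqrt h.le]
  ring

theorem landen_sq (r : ℝ) : landen (r ^ 2) = (2 * r / (1 + r ^ 2)) ^ 2 := by
  rw [landen, div_pow]
  ring

theorem integral_landen_pow (n : ℕ) :
    ∫ r in (0 : ℝ)..1, landen (r ^ 2) ^ n * (2 / (1 + r ^ 2)) = π / 2 * centralCoeff n := by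
  have h := intervalIntegral.integral_comp_mul_deriv (a := 0) (b := 1)
    (f := fun r => 2 * Real.arctan r) (f' := fun r => 2 * (1 / (1 + r ^ 2)))
    (g := fun θ => Real.sin θ ^ (2 * n))
    (fun r _ => (Real.hasDerivAt_arctan r).const_mul 2)
    (Continuous.continuousOn (continuous_const.mul (continuous_const.div (by fun_prop)
      fun r => by positivity))) (by fun_prop)
  rw [Real.arctan_zero, Real.arctan_one, mul_zero, show 2 * (π / 4) = π / 2 by ring,
    integral_sin_pow_even_half] at h
  rw [← h]
  refine intervalIntegral.integral_congr fun r _ => ?_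
  simp only [Function.comp_apply, landen_sq, sin_two_mul_arctan]
  rw [← pow_mul]
  ring

theorem intervalIntegral_congr_Ioo {f g : ℝ → ℝ} (h : ∀ x ∈ Ioo (0 : ℝ) 1, f x = g x) :
    ∫ x in (0 : ℝ)..1, f x = ∫ x in (0 : ℝ)..1, g x := by
  rw [intervalIntegral.integral_of_le zero_le_one, intervalIntegral.integral_of_le zero_le_one,
    integral_Ioc_eq_integral_Ioo, integral_Ioc_eq_integral_Ioo]
  exact setIntegral_congr_fun measurableSet_Ioo h

/-- Nonnegativity turns summability of the integrals into summability of the L¹ norms. The pointwise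
sum is needed only on the open interval, so singular endpoints do not matter. -/
theorem hasSum_intervalIntegral_of_nonneg {F : ℕ → ℝ → ℝ} {f : ℝ → ℝ}
    (hF : ∀ n, IntervalIntegrable (F n) volume 0 1) (h0 : ∀ n, ∀ x ∈ Ioo (0 : ℝ) 1, 0 ≤ F n x)
    (hs : Summable fun n => ∫ x in (0 : ℝ)..1, F n x)
    (hf : ∀ x ∈ Ioo (0 : ℝ) 1, ∑' n, F n x = f x) :
    HasSum (fun n => ∫ x in (0 : ℝ)..1, F n x) (∫ x in (0 : ℝ)..1, f x) := by
  have hi : ∀ g : ℝ → ℝ, ∫ x in (0 : ℝ)..1, g x = ∫ x in Ioo (0 : ℝ) 1, g x := fun g => by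
    rw [intervalIntegral.integral_of_le zero_le_one, integral_Ioc_eq_integral_Ioo]
  simp only [hi] at hs ⊢
  have h := hasSum_integral_of_summable_integral_norm (F := F)
    (μ := volume.restrict (Ioo (0 : ℝ) 1))
    (fun n => (intervalIntegrable_iff_integrableOn_Ioo_of_le zero_le_one).1 (hF n))
    (hs.congr fun n => setIntegral_congr_fun measurableSet_Ioo fun x hx =>
      (Real.norm_of_nonneg (h0 n x hx)).symm)
  rwa [setIntegral_congr_fun measurableSet_Ioo hf] at h

theorem hasSum_integral_powerSum_landen {v : ℕ → ℝ} (hv : ∀ n, 0 ≤ v n)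
    (hs : Summable fun n => v n * centralCoeff n) :
    HasSum (fun n => π / 2 * (v n * centralCoeff n))
      (∫ r in (0 : ℝ)..1, powerSum v (landen (r ^ 2)) * (2 / (1 + r ^ 2))) := by
  have hi : ∀ n, ∫ r in (0 : ℝ)..1, v n * (landen (r ^ 2) ^ n * (2 / (1 + r ^ 2)))
      = π / 2 * (v n * centralCoeff n) := fun n => by
    rw [intervalIntegral.integral_const_mul, integral_landen_pow]
    ring
  have h := hasSum_intervalIntegral_of_nonneg
    (F := fun n r => v n * (landen (r ^ 2) ^ n * (2 / (1 + r ^ 2))))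
    (f := fun r => powerSum v (landen (r ^ 2)) * (2 / (1 + r ^ 2))) (fun n => ?_)
    (fun n r _ => ?_) ?_ fun r _ => ?_
  · simpa only [hi] using h
  · refine Continuous.intervalIntegrable ?_ _ _
    simp only [landen_sq]
    have : ∀ r : ℝ, 1 + r ^ 2 ≠ 0 := fun r => by positivity
    fun_prop (disch := assumption)
  · have := landen_nonneg (sq_nonneg r)
    have := hv n
    positivity
  · simpa only [hi] using hs.mul_left _
  · rw [powerSum, ← tsum_mul_right]
    exact tsum_congr fun n => by ring

/-! ### The two reduced harmonic sums as integrals -/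

theorem tsum_harmonic_div_eq_integral :
    ∑' n : ℕ, (harmonic n : ℝ) / n * centralSq n
      = 8 / π * ∫ r in (0 : ℝ)..1, polylog 2 (r ^ 2) / (1 + r ^ 2) := by
  have e : ∀ n : ℕ, centralCoeff n * ((harmonic n : ℝ) / n) * centralCoeff n
      = (harmonic n : ℝ) / n * centralSq n := fun n => by rw [centralSq_eq]; ring
  have h := hasSum_integral_powerSum_landen
    (v := fun n => centralCoeff n * ((harmonic n : ℝ) / n))
    (fun n => mul_nonneg (centralCoeff_pos n).le (div_nonneg (harmonic_nonneg n) n.cast_nonneg))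
    (summable_centralSq_harmonic_div.congr fun n => (e n).symm)
  simp only [e] at h
  have h2 : ∫ r in (0 : ℝ)..1, powerSum (fun n => centralCoeff n * ((harmonic n : ℝ) / n))
      (landen (r ^ 2)) * (2 / (1 + r ^ 2))
      = ∫ r in (0 : ℝ)..1, 4 * (polylog 2 (r ^ 2) / (1 + r ^ 2)) :=
    intervalIntegral_congr_Ioo fun r hr => by
      rw [powerSum_dilog_landen ⟨sq_nonneg r, pow_lt_one₀ hr.1.le hr.2 two_ne_zero⟩]
      ring
  have h3 := h.tsum_eq
  rw [h2, intervalIntegral.integral_const_mul, tsum_mul_left] at h3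
  have := Real.pi_pos
  field_simp at h3 ⊢
  linarith

/-- A derivative of constant sign with continuous primitive is automatically integrable, so an
unbounded integrand needs no separate estimate. -/
theorem intervalIntegral_eq_of_hasDerivAt_of_nonpos {F f : ℝ → ℝ}
    (hc : ContinuousOn F (Icc 0 1)) (hd : ∀ x ∈ Ioo (0 : ℝ) 1, HasDerivAt F (f x) x)
    (h0 : ∀ x ∈ Ioo (0 : ℝ) 1, f x ≤ 0) :
    IntervalIntegrable f volume 0 1 ∧ ∫ x in (0 : ℝ)..1, f x = F 1 - F 0 := by
  have h := intervalIntegral.intervalIntegrable_deriv_of_nonneg (a := 0) (b := 1)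
    (g := fun x => -F x) (g' := fun x => -f x) (by rw [uIcc_of_le zero_le_one]; exact hc.neg)
    (fun x hx => (hd x (by simpa using hx)).neg)
    (fun x hx => neg_nonneg.2 (h0 x (by simpa using hx)))
  have h' : IntervalIntegrable f volume 0 1 := by
    convert! h.neg using 1
    funext x
    simp
  exact ⟨h', intervalIntegral.integral_eq_sub_of_hasDerivAt_of_le zero_le_one hc hd h'⟩

theorem integral_log_one_sub_sq :
    IntervalIntegrable (fun r : ℝ => (1 - r ^ 2) / r ^ 2 * Real.log (1 - r ^ 2)) volume 0 1 ∧
    ∫ r in (0 : ℝ)..1, (1 - r ^ 2) / r ^ 2 * Real.log (1 - r ^ 2) = 2 - 4 * Real.log 2 := by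
  set N : ℝ → ℝ := fun r => (1 - r) ^ 2 * Real.log (1 - r) + (1 + r) ^ 2 * Real.log (1 + r)
    with hN
  have hNd : ∀ r ∈ Ico (0 : ℝ) 1, HasDerivAt N (-2 * (1 - r) * Real.log (1 - r) - (1 - r)
      + 2 * (1 + r) * Real.log (1 + r) + (1 + r)) r := fun r hr => by
    have h1 : 1 + r ≠ 0 := by linarith [hr.1]
    have h2 : 1 - r ≠ 0 := by linarith [hr.2]
    have d1 := (hasDerivAt_id r).const_add 1
    have d2 := (hasDerivAt_id r).const_sub 1
    convert! ((d2.pow 2).mul (d2.log h2)).add ((d1.pow 2).mul (d1.log h1)) using 1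
    simp only [id, Pi.pow_apply]
    field_simp
    ring
  have hN0 : N 0 = 0 := by simp [hN]
  have hds : ∀ r ≠ 0, dslope N 0 r = N r / r := fun r hr => by
    rw [dslope_of_ne _ hr, slope_def_field, hN0, sub_zero, sub_zero]
  -- The primitive is -N(r)/r + 2r; `dslope` fills the removable singularity at 0 with N'(0) = 0,
  -- and continuity at 1 comes from that of x log x.
  have hcont : ContinuousOn (fun r => -dslope N 0 r + 2 * r) (Icc 0 1) := by
    refine ContinuousOn.add (ContinuousOn.neg fun r hr => ?_) (by fun_prop)
    rcases eq_or_ne r 0 with rfl | h0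
    · exact (continuousAt_dslope_same.2
        (hNd 0 (by simp)).differentiableAt).continuousWithinAt
    · refine ((continuousWithinAt_dslope_of_ne h0).2 ?_)
      have hc : ContinuousOn N (Icc 0 1) := by
        refine ContinuousOn.add ?_ ?_
        · have : (fun r : ℝ => (1 - r) ^ 2 * Real.log (1 - r))
              = fun r => (1 - r) * ((1 - r) * Real.log (1 - r)) := by funext r; ring
          rw [this]
          exact (Continuous.mul (by fun_prop)
            (Real.continuous_mul_log.comp (by fun_prop : Continuous fun r : ℝ => 1 - r))).continuousOn
        · exact ContinuousOn.mul (by fun_prop) (ContinuousOn.log (by fun_prop)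
            fun x hx => by linarith [hx.1])
      exact hc r hr
  have h := intervalIntegral_eq_of_hasDerivAt_of_nonpos hcont (f := fun r =>
    (1 - r ^ 2) / r ^ 2 * Real.log (1 - r ^ 2)) (fun r hr => ?_) fun r hr => ?_
  · refine ⟨h.1, ?_⟩
    rw [h.2, dslope_same, (hNd 0 (by simp)).deriv, hds 1 one_ne_zero]
    simp [hN]
    norm_num
    ring
  · have h0 : r ≠ 0 := hr.1.ne'
    have h1 : 1 + r ≠ 0 := by linarith [hr.1]
    have h2 : 1 - r ≠ 0 := by linarith [hr.2]
    have hd : HasDerivAt (fun r => -(N r / r) + 2 * r)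
        ((1 - r ^ 2) / r ^ 2 * Real.log (1 - r ^ 2)) r := by
      convert! (((hNd r ⟨hr.1.le, hr.2⟩).div (hasDerivAt_id r) h0).neg).add
        ((hasDerivAt_id r).const_mul 2) using 1
      rw [show 1 - r ^ 2 = (1 - r) * (1 + r) by ring, Real.log_mul h2 h1]
      simp only [id, hN]
      field_simp
      ring
    refine hd.congr_of_eventuallyEq ?_
    filter_upwards [isOpen_ne.mem_nhds h0] with x hx
    rw [hds x hx]
  · have h1 : 0 < 1 - r ^ 2 := by nlinarith [hr.1, hr.2]
    refine mul_nonpos_of_nonneg_of_nonpos (by positivity)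
      (Real.log_nonpos h1.le (by nlinarith [hr.1]))

theorem tsum_harmonic_succ_div :
    ∑' n : ℕ, (harmonic (n + 1) : ℝ) / ((n : ℝ) + 1) * centralSq n
      = 16 * (1 - Real.log 2) / π := by
  have e : ∀ n : ℕ, centralCoeff n * ((harmonic (n + 1) : ℝ) / ((n : ℝ) + 1)) * centralCoeff n
      = (harmonic (n + 1) : ℝ) / ((n : ℝ) + 1) * centralSq n := fun n => by
    rw [centralSq_eq]; ring
  have h := hasSum_integral_powerSum_landen
    (v := fun n => centralCoeff n * ((harmonic (n + 1) : ℝ) / ((n : ℝ) + 1)))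
    (fun n => mul_nonneg (centralCoeff_pos n).le (div_nonneg (harmonic_nonneg _) (by positivity)))
    (summable_centralSq_harmonic.congr fun n => (e n).symm)
  simp only [e] at h
  have h2 : ∫ r in (0 : ℝ)..1, powerSum (fun n => centralCoeff n * ((harmonic (n + 1) : ℝ) /
      ((n : ℝ) + 1))) (landen (r ^ 2)) * (2 / (1 + r ^ 2))
      = ∫ r in (0 : ℝ)..1, (4 + 2 * ((1 - r ^ 2) / r ^ 2 * Real.log (1 - r ^ 2))) :=
    intervalIntegral_congr_Ioo fun r hr => by
      rw [powerSum_harmonic_div_landen ⟨by have := hr.1; positivity,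
        pow_lt_one₀ hr.1.le hr.2 two_ne_zero⟩]
      have : 1 + r ^ 2 ≠ 0 := by positivity
      have : r ≠ 0 := hr.1.ne'
      field_simp
      ring
  have h3 := h.tsum_eq
  rw [h2, intervalIntegral.integral_add (by simp) (integral_log_one_sub_sq.1.const_mul 2),
    intervalIntegral.integral_const_mul, integral_log_one_sub_sq.2, tsum_mul_left,
    intervalIntegral.integral_const] at h3
  have := Real.pi_pos
  field_simp at h3 ⊢
  simp only [sub_zero, smul_eq_mul] at h3
  linarith

/-! ### The power series of the elliptic integral -/

theorem powerSum_centralCoeff {y : ℝ} (hy : y ∈ Ico (0 : ℝ) 1) :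
    powerSum centralCoeff y = 1 / √(1 - y) := by
  have h1 : 0 < 1 - y := by linarith [hy.2]
  have hs : 0 < √(1 - y) := Real.sqrt_pos.2 h1
  have hs1 : √(1 - y) ≤ 1 := Real.sqrt_le_one.2 (by linarith [hy.1])
  have hs2 := Real.sq_sqrt h1.le
  set s := √(1 - y)
  -- Inverse of the substitution: y = 4q/(1+q)² for q = (1-s)/(1+s) with s = √(1-y).
  have hq : (1 - s) / (1 + s) ∈ Ico (0 : ℝ) 1 :=
    ⟨div_nonneg (by linarith) (by linarith), by rw [div_lt_one (by linarith)]; linarith⟩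
  have hl : landen ((1 - s) / (1 + s)) = y := by
    have h2 := one_sub_landen hq.1
    have e : (1 - (1 - s) / (1 + s)) / (1 + (1 - s) / (1 + s)) = s := by
      field_simp
      ring
    rw [e] at h2
    linarith
  rw [← hl, powerSum_centralCoeff_landen hq]
  have e1 : 1 + (1 - s) / (1 + s) = 2 / (1 + s) := by field_simp; ring
  have e2 : 1 - (1 - s) / (1 + s) = 2 * s / (1 + s) := by field_simp; ring
  rw [e1, e2]
  field_simp

theorem ellipticK_eq_integral (x : ℝ) (hx : x ∈ Ioo (0 : ℝ) 1) :
    ellipticK x = ∫ r in (0 : ℝ)..1, 1 / √(1 - x * landen (r ^ 2)) * (2 / (1 + r ^ 2)) := by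
  have h := intervalIntegral.integral_comp_mul_deriv (a := 0) (b := 1)
    (f := fun r => 2 * Real.arctan r) (f' := fun r => 2 * (1 / (1 + r ^ 2)))
    (g := fun θ => 1 / √(1 - x * Real.sin θ ^ 2))
    (fun r _ => (Real.hasDerivAt_arctan r).const_mul 2)
    (Continuous.continuousOn (continuous_const.mul (continuous_const.div (by fun_prop)
      fun r => by positivity)))
    (continuous_const.div (by fun_prop) fun θ => by
      have h1 := Real.sin_sq_le_one θ
      have : 0 < 1 - x * Real.sin θ ^ 2 := by nlinarith [hx.1, hx.2]
      exact (Real.sqrt_pos.2 this).ne')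
  rw [Real.arctan_zero, Real.arctan_one, mul_zero, show 2 * (π / 4) = π / 2 by ring] at h
  rw [ellipticK, ← h]
  refine intervalIntegral.integral_congr fun r _ => ?_
  simp only [Function.comp_apply, landen_sq, sin_two_mul_arctan]
  ring

theorem tsum_centralSq_mul_pow {x : ℝ} (hx : x ∈ Ioo (0 : ℝ) 1) :
    ∑' n : ℕ, π / 2 * (centralSq n * x ^ n) = ellipticK x := by
  have hx' : ‖x‖ < 1 := by rw [Real.norm_of_nonneg hx.1.le]; exact hx.2
  have e : ∀ n : ℕ, centralCoeff n * x ^ n * centralCoeff n = centralSq n * x ^ n :=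
    fun n => by rw [centralSq_eq]; ring
  have hs : Summable fun n : ℕ => centralSq n * x ^ n := by
    refine summable_powerSum (C := 1) (norm_le_mul_succ fun n => ?_) hx'
    rw [centralSq_eq, norm_pow]
    exact pow_le_one₀ (norm_nonneg _) (norm_centralCoeff_le n)
  have h := hasSum_integral_powerSum_landen (v := fun n => centralCoeff n * x ^ n)
    (fun n => mul_nonneg (centralCoeff_pos n).le (pow_nonneg hx.1.le n))
    (hs.congr fun n => (e n).symm)
  simp only [e] at h
  rw [h.tsum_eq, ellipticK_eq_integral x hx]
  refine intervalIntegral_congr_Ioo fun r hr => ?_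
  congr 1
  have h1 := landen_nonneg (sq_nonneg r)
  have h2 := norm_landen_lt_one (q := r ^ 2)
    ⟨sq_nonneg r, pow_lt_one₀ hr.1.le hr.2 two_ne_zero⟩
  rw [Real.norm_of_nonneg h1] at h2
  rw [← powerSum_centralCoeff ⟨mul_nonneg hx.1.le h1, by nlinarith [hx.1, hx.2]⟩]
  exact tsum_congr fun n => by rw [mul_pow]; ring

/-! ### Moments of the trilogarithm -/

theorem summable_one_div_succ_pow (k : ℕ) :
    Summable fun n : ℕ => 1 / ((n : ℝ) + 1) ^ (k + 2) := by
  simpa using summable_polylog k (z := (1 : ℝ)) (by simp)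

theorem hasSum_one_div_sub (m : ℕ) :
    HasSum (fun k : ℕ => 1 / ((k : ℝ) + 1) - 1 / ((k : ℝ) + 1 + m)) (harmonic m : ℝ) := by
  induction m with
  | zero => simp [hasSum_zero]
  | succ m ih =>
    have hs : Summable fun k : ℕ => 1 / ((k : ℝ) + 1 + m) - 1 / ((k : ℝ) + 2 + m) := by
      have hk : ∀ k : ℕ, 1 / ((k : ℝ) + 1 + m) - 1 / ((k : ℝ) + 2 + m)
          = 1 / (((k : ℝ) + 1 + m) * ((k : ℝ) + 2 + m)) := fun k => by
        field_simp
        ring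
      simp only [hk]
      refine Summable.of_nonneg_of_le (fun k => by positivity) (fun k => ?_)
        summable_one_div_succ_sq
      rw [sq]
      have : (0 : ℝ) ≤ m := m.cast_nonneg
      exact one_div_le_one_div_of_le (by positivity)
        (mul_le_mul (by linarith) (by linarith) (by positivity) (by positivity))
    have hl : Tendsto (fun k : ℕ => -(1 / ((k : ℝ) + 1 + m))) atTop (𝓝 0) := by
      have := (tendsto_one_div_add_atTop_nhds_zero_nat (𝕜 := ℝ)).comp (tendsto_add_atTop_nat m)
      simpa [Function.comp_def, add_right_comm] using this.neg
    have h := ih.add (hasSum_of_telescope hs (fun k => by push_cast; ring) hl)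
    convert! h using 1
    · funext k
      push_cast
      ring
    · rw [harmonic_cast_succ]
      simp [add_comm]

theorem zetaReal_eq_tsum (k : ℕ) : zetaReal (k + 2) = ∑' n : ℕ, 1 / ((n : ℝ) + 1) ^ (k + 2) := by
  have h := zeta_nat_eq_tsum_of_gt_one (k := k + 2) (by omega)
  have e : (∑' n : ℕ, 1 / (n : ℂ) ^ (k + 2)) = ((∑' n : ℕ, 1 / (n : ℝ) ^ (k + 2) : ℝ) : ℂ) := by
    push_cast
    rfl
  rw [zetaReal, h, e, Complex.ofReal_re,
    (Real.summable_one_div_nat_pow.2 (by omega)).tsum_eq_zero_add]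
  simp

theorem zetaReal_two : zetaReal 2 = π ^ 2 / 6 := by
  rw [zetaReal]
  push_cast
  rw [riemannZeta_two]
  norm_cast

/-- Partial fractions in k + 1 with m = n + 1: the cubic and quadratic poles give ζ(3)/m and
-ζ(2)/m², and the remaining difference sums to H_m/m³ by `hasSum_one_div_sub`. -/
theorem hasSum_trilog_moment (n : ℕ) :
    HasSum (fun k : ℕ => 1 / (((k : ℝ) + 1) ^ 3 * ((k : ℝ) + n + 2)))
      (zetaReal 3 / ((n : ℝ) + 1) - zetaReal 2 / ((n : ℝ) + 1) ^ 2
        + (harmonic (n + 1) : ℝ) / ((n : ℝ) + 1) ^ 3) := by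
  have h3 := (summable_one_div_succ_pow 1).hasSum
  have h2 := (summable_one_div_succ_pow 0).hasSum
  rw [← zetaReal_eq_tsum] at h3 h2
  convert! ((h3.div_const ((n : ℝ) + 1)).sub (h2.div_const (((n : ℝ) + 1) ^ 2))).add
    ((hasSum_one_div_sub (n + 1)).div_const (((n : ℝ) + 1) ^ 3)) using 1
  funext k
  have h : (k : ℝ) + 1 + (n + 1) ≠ 0 := by positivity
  have h' : (k : ℝ) + n + 2 ≠ 0 := by positivity
  push_cast
  rw [show (k : ℝ) + 1 + (n + 1) = (k : ℝ) + n + 2 by ring]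
  field_simp
  ring

theorem continuousOn_trilog : ContinuousOn (trilog : ℝ → ℝ) (Icc 0 1) :=
  (continuousOn_polylog (𝕜 := ℝ) 1).mono fun x hx => by
    rw [mem_closedBall_zero_iff, Real.norm_of_nonneg hx.1]
    exact hx.2

theorem integral_pow_mul_trilog (n : ℕ) :
    ∫ x in (0 : ℝ)..1, x ^ n * trilog x
      = zetaReal 3 / ((n : ℝ) + 1) - zetaReal 2 / ((n : ℝ) + 1) ^ 2
        + (harmonic (n + 1) : ℝ) / ((n : ℝ) + 1) ^ 3 := by
  have hi : ∀ k : ℕ, ∫ x in (0 : ℝ)..1, x ^ (n + k + 1) / ((k : ℝ) + 1) ^ 3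
      = 1 / (((k : ℝ) + 1) ^ 3 * ((k : ℝ) + n + 2)) := fun k => by
    rw [intervalIntegral.integral_div, integral_pow]
    push_cast
    simp only [one_pow, ne_eq, Nat.add_eq_zero_iff, one_ne_zero, and_false, not_false_eq_true,
      zero_pow, sub_zero]
    rw [show (n : ℝ) + k + 1 + 1 = k + n + 2 by ring]
    field_simp
  have h := hasSum_intervalIntegral_of_nonneg
    (F := fun k x => x ^ (n + k + 1) / ((k : ℝ) + 1) ^ 3) (f := fun x => x ^ n * trilog x)
    (fun k => Continuous.intervalIntegrable (by fun_prop) _ _)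
    (fun k x hx => by have := hx.1; positivity)
    (by simpa only [hi] using (hasSum_trilog_moment n).summable)
    (fun x _ => by
      rw [trilog, ← tsum_mul_left]
      exact tsum_congr fun k => by ring)
  simp only [hi] at h
  exact h.unique (hasSum_trilog_moment n)

/-! ### Termwise integration of Li₃ · K -/

theorem summable_moment_mul_centralSq : Summable fun n : ℕ =>
    (zetaReal 3 / ((n : ℝ) + 1) - zetaReal 2 / ((n : ℝ) + 1) ^ 2
      + (harmonic (n + 1) : ℝ) / ((n : ℝ) + 1) ^ 3) * centralSq n :=
  ((((summable_centralSq_div.mul_left (zetaReal 3)).sub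
    (hasSum_centralSq_div_sq.summable.mul_left (zetaReal 2))).add
    (summable_centralSq_harmonic_pow 2))).congr fun n => by ring

theorem hasSum_integral_trilog_mul_ellipticK :
    HasSum (fun n : ℕ => π / 2 * ((zetaReal 3 / ((n : ℝ) + 1) - zetaReal 2 / ((n : ℝ) + 1) ^ 2
      + (harmonic (n + 1) : ℝ) / ((n : ℝ) + 1) ^ 3) * centralSq n))
      (∫ x in (0 : ℝ)..1, trilog x * ellipticK x) := by
  have hi : ∀ n : ℕ, ∫ x in (0 : ℝ)..1, π / 2 * centralSq n * (x ^ n * trilog x)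
      = π / 2 * ((zetaReal 3 / ((n : ℝ) + 1) - zetaReal 2 / ((n : ℝ) + 1) ^ 2
      + (harmonic (n + 1) : ℝ) / ((n : ℝ) + 1) ^ 3) * centralSq n) := fun n => by
    rw [intervalIntegral.integral_const_mul, integral_pow_mul_trilog]
    ring
  have h := hasSum_intervalIntegral_of_nonneg
    (F := fun n x => π / 2 * centralSq n * (x ^ n * trilog x))
    (f := fun x => trilog x * ellipticK x)
    (fun n => ContinuousOn.intervalIntegrable (by
      rw [uIcc_of_le zero_le_one]
      exact continuousOn_const.mul ((continuousOn_pow n).mul continuousOn_trilog)))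
    (fun n x hx => by
      have h1 := centralSq_nonneg n
      have h2 : 0 ≤ trilog x := tsum_nonneg fun k => by have := hx.1; positivity
      have h3 := hx.1
      positivity)
    (by simpa only [hi] using summable_moment_mul_centralSq.mul_left (π / 2))
    (fun x hx => by
      rw [← tsum_centralSq_mul_pow hx, ← tsum_mul_left]
      exact tsum_congr fun n => by ring)
  simpa only [hi] using h

theorem integral_trilog_mul_ellipticK_pos :
    0 < ∫ x in (0 : ℝ)..1, trilog x * ellipticK x := by
  have hm : ∀ n : ℕ, 0 < π / 2 * ((zetaReal 3 / ((n : ℝ) + 1) - zetaReal 2 / ((n : ℝ) + 1) ^ 2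
      + (harmonic (n + 1) : ℝ) / ((n : ℝ) + 1) ^ 3) * centralSq n) := fun n => by
    have h := hasSum_trilog_moment n
    have h1 := centralSq_pos n
    have h2 := h.summable.tsum_pos (fun k => by positivity) 0 (by positivity)
    rw [h.tsum_eq] at h2
    positivity
  have h := hasSum_integral_trilog_mul_ellipticK
  rw [← h.tsum_eq]
  exact h.summable.tsum_pos (fun n => (hm n).le) 0 (hm 0)

/-- The integral of a non-integrable function is 0 by convention, whereas this integral is a sum of
positive terms. -/
theorem intervalIntegrable_trilog_mul_ellipticK :
    IntervalIntegrable (fun x : ℝ => trilog x * ellipticK x) volume 0 1 := by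
  by_contra h
  exact integral_trilog_mul_ellipticK_pos.ne' (intervalIntegral.integral_undef h)

/-! ### A primitive of `log² w · u / (1 - u w) / 2` -/

/-- A primitive of `log² w · u / (1 - u w) / 2` in the unit disc. -/
noncomputable def logSqPrimitive (u w : ℂ) : ℂ :=
  polylog 3 (u * w) - Complex.log w * polylog 2 (u * w)
    - 1 / 2 * (Complex.log w ^ 2 * Complex.log (1 - u * w))

/-- The product rule telescopes: the Li₂ terms cancel, and so do the log w · log(1-uw)/w terms
because Li₁(z) = -log(1-z). -/
theorem hasDerivAt_logSqPrimitive {u w : ℂ} (hu : ‖u‖ = 1) (hw : ‖w‖ < 1)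
    (hw' : w ∈ Complex.slitPlane) :
    HasDerivAt (logSqPrimitive u) (1 / 2 * Complex.log w ^ 2 * (u / (1 - u * w))) w := by
  have hw0 : w ≠ 0 := Complex.slitPlane_ne_zero hw'
  have hu0 : u ≠ 0 := by rw [← norm_ne_zero_iff, hu]; exact one_ne_zero
  have hn : ‖u * w‖ < 1 := by rwa [norm_mul, hu, one_mul]
  have h0 : u * w ≠ 0 := mul_ne_zero hu0 hw0
  have hs : 1 - u * w ∈ Complex.slitPlane := by
    rw [sub_eq_add_neg]
    exact Complex.mem_slitPlane_of_norm_lt_one (by rwa [norm_neg])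
  have hs0 := Complex.slitPlane_ne_zero hs
  have dm : HasDerivAt (fun w => u * w) u w := by simpa using (hasDerivAt_id w).const_mul u
  have d3 := (hasDerivAt_polylog 2 hn h0).comp w dm
  have d2 := (hasDerivAt_polylog 1 hn h0).comp w dm
  have dl := Complex.hasDerivAt_log hw'
  have dl1 := (dm.const_sub 1).clog hs
  convert! (d3.sub (dl.mul d2)).sub (((dl.pow 2).mul dl1).const_mul (1 / 2)) using 1
  simp only [Nat.reduceAdd, Function.comp_apply, polylog_one_complex hn, Pi.pow_apply]
  field_simp
  ring

theorem norm_log_le (w : ℂ) : ‖Complex.log w‖ ≤ |Real.log ‖w‖| + π := by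
  refine (Complex.norm_le_abs_re_add_abs_im _).trans ?_
  rw [Complex.log_re, Complex.log_im]
  gcongr
  exact Complex.abs_arg_le_pi w

theorem tendsto_log_mul_self : Tendsto (fun w : ℂ => Complex.log w * w) (𝓝 0) (𝓝 0) := by
  have hc : Continuous fun w : ℂ => |‖w‖ * Real.log ‖w‖| + π * ‖w‖ :=
    (Real.continuous_mul_log.comp continuous_norm).abs.add (by fun_prop)
  refine squeeze_zero_norm (fun w => ?_) (by simpa using hc.tendsto 0)
  rw [norm_mul]
  have := mul_le_mul_of_nonneg_right (norm_log_le w) (norm_nonneg w)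
  linarith

theorem tendsto_log_sq_mul_self : Tendsto (fun w : ℂ => Complex.log w ^ 2 * w) (𝓝 0) (𝓝 0) := by
  -- Writing log ‖w‖ = 2 log √‖w‖ and ‖w‖ = (√‖w‖)² reduces the claim to continuity of x log x at 0.
  have hc : Continuous fun w : ℂ => (2 * |√‖w‖ * Real.log √‖w‖| + π * √‖w‖) ^ 2 :=
    ((continuous_const.mul (Real.continuous_mul_log.comp continuous_norm.sqrt).abs).add
      (by fun_prop)).pow 2
  refine squeeze_zero_norm (fun w => ?_) (by simpa using hc.tendsto 0)
  have h := norm_log_le w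
  have hs := Real.sq_sqrt (norm_nonneg w)
  rw [norm_mul, norm_pow, Real.log_sqrt (norm_nonneg w),
    abs_of_nonneg (Real.sqrt_nonneg ‖w‖), abs_div, abs_two]
  calc ‖Complex.log w‖ ^ 2 * ‖w‖ ≤ (|Real.log ‖w‖| + π) ^ 2 * ‖w‖ := by gcongr
    _ = (|Real.log ‖w‖| + π) ^ 2 * √‖w‖ ^ 2 := by rw [hs]
    _ = _ := by ring

theorem norm_log_one_sub_le {z : ℂ} (hz : ‖z‖ ≤ 1 / 2) : ‖Complex.log (1 - z)‖ ≤ 3 / 2 * ‖z‖ := by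
  have := Complex.norm_log_one_add_half_le_self (z := -z) (by rwa [norm_neg])
  rwa [norm_neg, ← sub_eq_add_neg] at this

theorem eventually_norm_le_half (z : ℂ) : ∀ᶠ w in 𝓝 z, ‖w - z‖ ≤ 1 / 2 := by
  filter_upwards [Metric.ball_mem_nhds z one_half_pos] with w hw
  exact (mem_ball_iff_norm.1 hw).le

theorem continuousAt_log_sq_mul_log_one_sub_one :
    ContinuousAt (fun w : ℂ => Complex.log w ^ 2 * Complex.log (1 - w)) 1 := by
  have h1 : Tendsto (fun w : ℂ => 1 - w) (𝓝 1) (𝓝 0) := by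
    have : Continuous fun w : ℂ => 1 - w := by fun_prop
    simpa using this.tendsto 1
  have h2 := ((tendsto_log_mul_self.comp h1).norm.mul h1.norm).const_mul (9 / 4)
  simp only [norm_zero, mul_zero] at h2
  rw [ContinuousAt, Complex.log_one, zero_pow two_ne_zero, zero_mul]
  refine squeeze_zero_norm' ?_ h2
  filter_upwards [eventually_norm_le_half 1] with w hw
  rw [norm_sub_rev] at hw
  have h := norm_log_one_sub_le hw
  rw [sub_sub_cancel] at h
  rw [norm_mul, norm_pow, Function.comp_apply, norm_mul]
  calc _ ≤ (3 / 2 * ‖1 - w‖) ^ 2 * ‖Complex.log (1 - w)‖ := by gcongr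
    _ = _ := by ring

theorem norm_polylog_le (k : ℕ) {z : ℂ} (hz : ‖z‖ ≤ 1) :
    ‖polylog (k + 2) z‖ ≤ (∑' n : ℕ, 1 / ((n : ℝ) + 1) ^ 2) * ‖z‖ := by
  rw [← tsum_mul_right]
  refine tsum_of_norm_bounded (summable_one_div_succ_sq.mul_right _).hasSum fun n => ?_
  have h := norm_polylog_term_le (𝕜 := ℂ) k n (z := 1) (by simp)
  rw [one_pow] at h
  rw [pow_succ, mul_div_assoc, mul_comm (z ^ n), div_eq_mul_one_div z, mul_assoc, norm_mul,
    mul_comm, mul_comm (1 / _), norm_mul, norm_pow]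
  have h2 : ‖z‖ ^ n ≤ 1 := pow_le_one₀ (norm_nonneg z) hz
  have h3 : ‖1 / ((n : ℂ) + 1) ^ (k + 2)‖ * ‖z‖ ^ n ≤ 1 / ((n : ℝ) + 1) ^ 2 * 1 := by gcongr
  rw [mul_one] at h3
  exact mul_le_mul_of_nonneg_right h3 (norm_nonneg z) |>.trans_eq' (by ring) |>.trans_eq (by ring)

/-- The delicate points are w = 0, where powers of log w are beaten by a factor O(w), and uw = 1,
where log² w tames log(1-uw). With Re w > 0 the latter occurs only for u = w = 1, since u = -i would
force w = i. -/
theorem continuousWithinAt_logSqPrimitive {u w : ℂ} (hu : u = 1 ∨ u = -Complex.I)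
    (hw1 : ‖w‖ ≤ 1) (hw : 0 < w.re ∨ w = 0) :
    ContinuousWithinAt (logSqPrimitive u) (Metric.closedBall 0 1) w := by
  have hun : ‖u‖ = 1 := by rcases hu with rfl | rfl <;> simp
  have hmaps : MapsTo (fun w => u * w) (Metric.closedBall 0 1) (Metric.closedBall 0 1) :=
    fun x hx => by simpa [hun] using hx
  have hmem : w ∈ Metric.closedBall (0 : ℂ) 1 := by simpa using hw1
  have hcm : ContinuousWithinAt (fun w => u * w) (Metric.closedBall 0 1) w := by fun_prop
  have c3 := ((continuousOn_polylog (𝕜 := ℂ) 1) (u * w) (hmaps hmem)).comp hcm hmaps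
  have c2 := ((continuousOn_polylog (𝕜 := ℂ) 0) (u * w) (hmaps hmem)).comp hcm hmaps
  rcases hw with hw | rfl
  · have hsl : w ∈ Complex.slitPlane := Or.inl hw
    have cl := (continuousAt_clog hsl).continuousWithinAt (s := Metric.closedBall 0 1)
    refine (c3.sub (cl.mul c2)).sub (ContinuousWithinAt.mul continuousWithinAt_const ?_)
    rcases eq_or_ne (u * w) 1 with h1 | h1
    · rcases hu with rfl | rfl
      · rw [one_mul] at h1
        subst h1
        simpa using continuousAt_log_sq_mul_log_one_sub_one.continuousWithinAt
      · have : w = Complex.I := by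
          linear_combination Complex.I * h1 + w * Complex.I_sq
        rw [this] at hw
        simp at hw
    · have hs : 1 - u * w ∈ Complex.slitPlane := by
        left
        have h2 : ‖u * w‖ ≤ 1 := by rwa [norm_mul, hun, one_mul]
        have h3 := Complex.re_le_norm (u * w)
        rw [Complex.sub_re, Complex.one_re, sub_pos]
        refine lt_of_le_of_ne (h3.trans h2) fun h4 => h1 ?_
        have h5 := Complex.sq_norm (u * w)
        rw [Complex.normSq_apply, h4] at h5
        have h6 : (u * w).im = 0 := by
          have : ‖u * w‖ ^ 2 ≤ 1 := pow_le_one₀ (norm_nonneg _) h2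
          nlinarith [sq_nonneg (u * w).im]
        exact Complex.ext (by simpa using h4) (by simpa using h6)
      exact (cl.pow 2).mul ((continuousWithinAt_const.sub hcm).clog hs)
  · have e : logSqPrimitive u 0 = 0 := by simp [logSqPrimitive, polylog_zero]
    refine ContinuousWithinAt.sub (ContinuousWithinAt.sub c3 ?_) ?_
    · rw [ContinuousWithinAt]
      simp only [mul_zero, polylog_zero]
      have h := (tendsto_log_mul_self.mono_left (nhdsWithin_le_nhds (s := Metric.closedBall 0 1))
        ).norm.mul_const (∑' n : ℕ, 1 / ((n : ℝ) + 1) ^ 2)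
      rw [norm_zero, zero_mul] at h
      refine squeeze_zero_norm' ?_ h
      filter_upwards [self_mem_nhdsWithin] with x hx
      have h1 := norm_polylog_le 0 (by simpa using hmaps hx : ‖u * x‖ ≤ 1)
      rw [norm_mul u, hun, one_mul] at h1
      rw [norm_mul, norm_mul]
      calc _ ≤ ‖Complex.log x‖ * ((∑' n : ℕ, 1 / ((n : ℝ) + 1) ^ 2) * ‖x‖) := by gcongr
        _ = _ := by ring
    · refine ContinuousWithinAt.mul continuousWithinAt_const (ContinuousAt.continuousWithinAt ?_)
      rw [ContinuousAt]
      simp only [mul_zero, sub_zero, Complex.log_one]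
      have h := tendsto_log_sq_mul_self.norm.const_mul (3 / 2)
      rw [norm_zero, mul_zero] at h
      refine squeeze_zero_norm' ?_ h
      filter_upwards [eventually_norm_le_half 0] with x hx
      rw [sub_zero] at hx
      have h1 := norm_log_one_sub_le (z := u * x) (by rwa [norm_mul, hun, one_mul])
      rw [norm_mul u, hun, one_mul] at h1
      rw [norm_mul, norm_mul]
      calc _ ≤ ‖Complex.log x ^ 2‖ * (3 / 2 * ‖x‖) := by gcongr
        _ = _ := by ring

/-! ### The primitive of the dilogarithm integrand -/

theorem one_add_mul_I_re (r : ℝ) : (1 + r * Complex.I).re = 1 := by simp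

theorem one_add_mul_I_mem (r : ℝ) : 1 + r * Complex.I ∈ Complex.slitPlane := by
  left
  rw [one_add_mul_I_re]
  exact one_pos

theorem one_add_mul_I_ne_zero (r : ℝ) : 1 + r * Complex.I ≠ 0 :=
  Complex.slitPlane_ne_zero (one_add_mul_I_mem r)

theorem sq_norm_one_add_mul_I (r : ℝ) : ‖1 + r * Complex.I‖ ^ 2 = 1 + r ^ 2 := by
  rw [Complex.sq_norm, Complex.normSq_apply]
  simp
  ring

theorem one_lt_norm_one_add_mul_I {r : ℝ} (hr : 0 < r) : 1 < ‖1 + r * Complex.I‖ := by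
  have h := sq_norm_one_add_mul_I r
  have := pow_pos hr 2
  nlinarith [norm_nonneg (1 + r * Complex.I)]

theorem one_le_norm_one_add_mul_I (r : ℝ) : 1 ≤ ‖1 + r * Complex.I‖ := by
  have h := sq_norm_one_add_mul_I r
  nlinarith [norm_nonneg (1 + r * Complex.I), sq_nonneg r]

theorem log_inv_one_add_mul_I (r : ℝ) :
    Complex.log (1 + r * Complex.I)⁻¹ = -Complex.log (1 + r * Complex.I) :=
  Complex.log_inv _ (Complex.mem_slitPlane_iff_arg.1 (one_add_mul_I_mem r)).1

theorem inv_one_add_mul_I_re_pos (r : ℝ) : 0 < ((1 + r * Complex.I)⁻¹).re := by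
  rw [Complex.inv_re, one_add_mul_I_re]
  exact div_pos one_pos (Complex.normSq_pos.2 (one_add_mul_I_ne_zero r))

theorem norm_inv_one_add_mul_I_le (r : ℝ) : ‖(1 + r * Complex.I)⁻¹‖ ≤ 1 := by
  rw [norm_inv]
  exact inv_le_one_of_one_le₀ (one_le_norm_one_add_mul_I r)

theorem norm_inv_one_add_mul_I_lt {r : ℝ} (hr : 0 < r) : ‖(1 + r * Complex.I)⁻¹‖ < 1 := by
  rw [norm_inv]
  exact inv_lt_one_of_one_lt₀ (one_lt_norm_one_add_mul_I hr)

theorem hasDerivAt_one_add_mul_I (r : ℝ) :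
    HasDerivAt (fun r : ℝ => 1 + (r : ℂ) * Complex.I) Complex.I r := by
  simpa using ((hasDerivAt_id r).ofReal_comp.mul_const Complex.I).const_add 1

/-- The path `(1 - r) / (1 + i r)` from `1` to `0`. -/
noncomputable def pathA (r : ℝ) : ℂ := ((1 - r : ℝ) : ℂ) * (1 + r * Complex.I)⁻¹

/-- The path `(1 + i r) / (1 + r)` from `1` to `(1 + i) / 2`. -/
noncomputable def pathB (r : ℝ) : ℂ := (((1 + r)⁻¹ : ℝ) : ℂ) * (1 + r * Complex.I)

theorem log_pathA {r : ℝ} (hr : r < 1) :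
    Complex.log (pathA r) = Real.log (1 - r) - Complex.log (1 + r * Complex.I) := by
  rw [pathA, Complex.log_ofReal_mul (by linarith) (inv_ne_zero (one_add_mul_I_ne_zero r)),
    log_inv_one_add_mul_I]
  ring

theorem log_pathB {r : ℝ} (hr : 0 ≤ r) :
    Complex.log (pathB r) = Complex.log (1 + r * Complex.I) - Real.log (1 + r) := by
  rw [pathB, Complex.log_ofReal_mul (by positivity) (one_add_mul_I_ne_zero r), Real.log_inv]
  push_cast
  ring

theorem pathA_re_pos {r : ℝ} (hr : r < 1) : 0 < (pathA r).re := by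
  rw [pathA, Complex.re_ofReal_mul]
  exact mul_pos (by linarith) (inv_one_add_mul_I_re_pos r)

theorem pathB_re_pos {r : ℝ} (hr : 0 ≤ r) : 0 < (pathB r).re := by
  rw [pathB, Complex.re_ofReal_mul, one_add_mul_I_re]
  positivity

theorem norm_pathA_le {r : ℝ} (hr : r ∈ Icc (0 : ℝ) 1) : ‖pathA r‖ ≤ 1 := by
  rw [pathA, norm_mul, Complex.norm_real, Real.norm_of_nonneg (by linarith [hr.2])]
  exact mul_le_one₀ (by linarith [hr.1]) (norm_nonneg _) (norm_inv_one_add_mul_I_le r)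

theorem norm_pathA_lt {r : ℝ} (hr : r ∈ Ioo (0 : ℝ) 1) : ‖pathA r‖ < 1 := by
  rw [pathA, norm_mul, Complex.norm_real, Real.norm_of_nonneg (by linarith [hr.2])]
  exact mul_lt_one_of_nonneg_of_lt_one_left (by linarith [hr.2]) (by linarith [hr.1])
    (norm_inv_one_add_mul_I_le r)

theorem norm_pathB_le {r : ℝ} (hr : 0 ≤ r) : ‖pathB r‖ ≤ 1 := by
  rw [pathB, norm_mul, Complex.norm_real, Real.norm_of_nonneg (by positivity),
    inv_mul_le_iff₀ (by linarith)]
  have h := sq_norm_one_add_mul_I r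
  nlinarith [norm_nonneg (1 + r * Complex.I)]

theorem norm_pathB_lt {r : ℝ} (hr : 0 < r) : ‖pathB r‖ < 1 := by
  rw [pathB, norm_mul, Complex.norm_real, Real.norm_of_nonneg (by positivity),
    inv_mul_lt_iff₀ (by linarith)]
  have h := sq_norm_one_add_mul_I r
  nlinarith [norm_nonneg (1 + r * Complex.I)]

theorem hasDerivAt_pathA (r : ℝ) :
    HasDerivAt pathA (-(1 + Complex.I) / (1 + r * Complex.I) ^ 2) r := by
  have h0 := one_add_mul_I_ne_zero r
  have d : HasDerivAt (fun r : ℝ => ((1 - r : ℝ) : ℂ)) (-1) r := by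
    simpa using ((hasDerivAt_id r).const_sub 1).ofReal_comp
  convert! d.mul ((hasDerivAt_one_add_mul_I r).inv h0) using 1
  simp only [Pi.inv_apply]
  push_cast
  field_simp
  ring

theorem hasDerivAt_pathB {r : ℝ} (hr : 0 ≤ r) :
    HasDerivAt pathB ((Complex.I - 1) / (1 + r) ^ 2) r := by
  have h0 : 1 + r ≠ 0 := by positivity
  have h1 : 1 + (r : ℂ) ≠ 0 := by exact_mod_cast h0
  have d : HasDerivAt (fun r : ℝ => (((1 + r)⁻¹ : ℝ) : ℂ)) (-1 / (1 + (r : ℂ)) ^ 2) r := by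
    simpa using (((hasDerivAt_id r).const_add 1).inv h0).ofReal_comp
  convert! d.mul (hasDerivAt_one_add_mul_I r) using 1
  push_cast
  field_simp
  ring

/-- Subtracting the primitives for u = 1 and u = -i produces ½ log² p times the logarithmic
derivative of (1 + ip)/(1 - p). -/
theorem hasDerivAt_logSqPrimitive_sub {p : ℝ → ℂ} {p' : ℂ} {r : ℝ} (hp : HasDerivAt p p' r)
    (h1 : ‖p r‖ < 1) (h2 : 0 < (p r).re) :
    HasDerivAt (fun r => logSqPrimitive 1 (p r) - logSqPrimitive (-Complex.I) (p r))
      (1 / 2 * Complex.log (p r) ^ 2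
        * ((1 + Complex.I) * p' / ((1 - p r) * (1 + Complex.I * p r)))) r := by
  have hn : ∀ u : ℂ, ‖u‖ = 1 → 1 - u * p r ≠ 0 := fun u hu h => by
    have e : u * p r = 1 := by linear_combination -h
    have := congrArg norm e
    rw [norm_mul, hu, one_mul, norm_one] at this
    exact h1.ne this
  have n1 := hn 1 norm_one
  have n2 := hn (-Complex.I) (by simp)
  have d1 := (hasDerivAt_logSqPrimitive norm_one h1 (Or.inl h2)).comp r hp
  have d2 := (hasDerivAt_logSqPrimitive (u := -Complex.I) (by simp) h1 (Or.inl h2)).comp r hp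
  convert! d1.sub d2 using 1
  rw [one_mul] at n1 ⊢
  rw [neg_mul, sub_neg_eq_add] at n2 ⊢
  field_simp
  ring

/-- A function whose imaginary part is a primitive of `arctan r * log (1 - r ^ 2) / r`. -/
noncomputable def arctanLogPrimitive (r : ℝ) : ℂ :=
  Complex.log (1 + r * Complex.I) ^ 3 / 3 - 2 * logSqPrimitive 1 (1 + r * Complex.I)⁻¹
    + (logSqPrimitive 1 (pathA r) - logSqPrimitive (-Complex.I) (pathA r))
    + (logSqPrimitive 1 (pathB r) - logSqPrimitive (-Complex.I) (pathB r))

/-- Put L = log(1+ir), A = log(1-r), B = log(1+r). The two paths contribute -(A-L)²/(2r) and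
-(L-B)²/(2r), that is (L(A+B) - A²/2 - B²/2 - L²)/r, and the first two terms of the primitive
contribute the missing L²/r. As A and B are real, the imaginary part is arctan r · log(1-r²)/r. -/
theorem hasDerivAt_arctanLogPrimitive {r : ℝ} (hr : r ∈ Ioo (0 : ℝ) 1) :
    HasDerivAt arctanLogPrimitive ((Complex.log (1 + r * Complex.I) * Real.log (1 - r ^ 2)
      - Real.log (1 - r) ^ 2 / 2 - Real.log (1 + r) ^ 2 / 2) / r) r := by
  have hI := Complex.I_sq
  have h0 := one_add_mul_I_ne_zero r
  have hr0 : (r : ℂ) ≠ 0 := by exact_mod_cast hr.1.ne'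
  have hr1 : (1 : ℂ) + r ≠ 0 := by exact_mod_cast (by linarith [hr.1] : 1 + r ≠ 0)
  have hI1 : (1 : ℂ) + Complex.I ≠ 0 := by simpa using one_add_mul_I_ne_zero 1
  have hd := hasDerivAt_one_add_mul_I r
  have dA := hasDerivAt_logSqPrimitive_sub (hasDerivAt_pathA r) (norm_pathA_lt hr)
    (pathA_re_pos hr.2)
  have dB := hasDerivAt_logSqPrimitive_sub (hasDerivAt_pathB hr.1.le) (norm_pathB_lt hr.1)
    (pathB_re_pos hr.1.le)
  have d1 := (hasDerivAt_logSqPrimitive norm_one (norm_inv_one_add_mul_I_lt hr.1)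
    (Or.inl (inv_one_add_mul_I_re_pos r))).comp r (hd.inv h0)
  have dl := ((hd.clog_real (one_add_mul_I_mem r)).pow 3).div_const 3
  have e1 : 1 - (1 : ℂ) * (1 + r * Complex.I)⁻¹ = r * Complex.I * (1 + r * Complex.I)⁻¹ := by
    field_simp
    ring
  have eA1 : 1 - pathA r = r * (1 + Complex.I) * (1 + r * Complex.I)⁻¹ := by
    rw [pathA]
    push_cast
    field_simp
    ring
  have eA2 : 1 + Complex.I * pathA r = (1 + Complex.I) * (1 + r * Complex.I)⁻¹ := by
    rw [pathA]
    push_cast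
    linear_combination -(mul_inv_cancel₀ h0)
  have eB1 : 1 - pathB r = r * (1 - Complex.I) * (1 + (r : ℂ))⁻¹ := by
    rw [pathB]
    push_cast
    field_simp
    ring
  have eB2 : 1 + Complex.I * pathB r = (1 + Complex.I) * (1 + (r : ℂ))⁻¹ := by
    rw [pathB]
    push_cast
    field_simp
    linear_combination (r : ℂ) * hI
  -- The quotient (1 + ip)/(1 - p) is 1/r on `pathA` and i/r on `pathB`, so its logarithmic
  -- derivative is -1/r on both.
  have eA : (1 + Complex.I) * (-(1 + Complex.I) / (1 + r * Complex.I) ^ 2)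
      / ((1 - pathA r) * (1 + Complex.I * pathA r)) = -1 / r := by
    rw [eA1, eA2]
    generalize 1 + (r : ℂ) * Complex.I = D at h0 ⊢
    field_simp
  have hI2 : (1 : ℂ) - Complex.I ≠ 0 := by
    have := one_add_mul_I_ne_zero (-1)
    push_cast at this
    rwa [neg_one_mul, ← sub_eq_add_neg] at this
  have eB : (1 + Complex.I) * ((Complex.I - 1) / (1 + r) ^ 2)
      / ((1 - pathB r) * (1 + Complex.I * pathB r)) = -1 / r := by
    rw [eB1, eB2]
    field_simp
    ring
  rw [eA, log_pathA hr.2] at dA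
  rw [eB, log_pathB hr.1.le] at dB
  have hlog : ((Real.log (1 - r ^ 2) : ℝ) : ℂ) = Real.log (1 - r) + Real.log (1 + r) := by
    rw [← Complex.ofReal_add, ← Real.log_mul (by linarith [hr.2]) (by linarith [hr.1])]
    congr 2
    ring
  convert! ((dl.sub (d1.const_mul 2)).add dA).add dB using 1
  rw [hlog, e1, log_inv_one_add_mul_I]
  have hI0 := Complex.I_ne_zero
  field_simp
  ring

theorem continuousOn_logSqPrimitive_comp {u : ℂ} (hu : u = 1 ∨ u = -Complex.I) {p : ℝ → ℂ}
    {s : Set ℝ} (hp : ContinuousOn p s) (h1 : ∀ r ∈ s, ‖p r‖ ≤ 1)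
    (h2 : ∀ r ∈ s, 0 < (p r).re ∨ p r = 0) : ContinuousOn (fun r => logSqPrimitive u (p r)) s :=
  fun r hr => (continuousWithinAt_logSqPrimitive hu (h1 r hr) (h2 r hr)).comp (hp r hr)
    fun x hx => by simpa using h1 x hx

theorem continuousOn_arctanLogPrimitive : ContinuousOn arctanLogPrimitive (Icc 0 1) := by
  have hA : ContinuousOn pathA (Icc 0 1) :=
    fun r _ => (hasDerivAt_pathA r).continuousAt.continuousWithinAt
  have hB : ContinuousOn pathB (Icc 0 1) :=
    fun r hr => (hasDerivAt_pathB hr.1).continuousAt.continuousWithinAt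
  have hA2 : ∀ r ∈ Icc (0 : ℝ) 1, 0 < (pathA r).re ∨ pathA r = 0 := fun r hr => by
    rcases hr.2.lt_or_eq with h | rfl
    · exact Or.inl (pathA_re_pos h)
    · exact Or.inr (by simp [pathA])
  have hB2 : ∀ r ∈ Icc (0 : ℝ) 1, 0 < (pathB r).re ∨ pathB r = 0 :=
    fun r hr => Or.inl (pathB_re_pos hr.1)
  have hc : ContinuousOn (fun r : ℝ => 1 + (r : ℂ) * Complex.I) (Icc 0 1) := by fun_prop
  have hl := hc.clog fun r _ => one_add_mul_I_mem r
  have hi := hc.inv₀ fun r _ => one_add_mul_I_ne_zero r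
  have cA := fun u hu => continuousOn_logSqPrimitive_comp (u := u) hu hA
    (fun r hr => norm_pathA_le hr) hA2
  have cB := fun u hu => continuousOn_logSqPrimitive_comp (u := u) hu hB
    (fun r hr => norm_pathB_le hr.1) hB2
  have c1 := continuousOn_logSqPrimitive_comp (Or.inl rfl) hi
    (fun r _ => norm_inv_one_add_mul_I_le r) fun r _ => Or.inl (inv_one_add_mul_I_re_pos r)
  exact ((((hl.pow 3).div_const 3).sub (continuousOn_const.mul c1)).add
    ((cA _ (Or.inl rfl)).sub (cA _ (Or.inr rfl)))).add
    ((cB _ (Or.inl rfl)).sub (cB _ (Or.inr rfl)))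

theorem mapsTo_sq_closedBall :
    MapsTo (fun r : ℝ => r ^ 2) (Icc 0 1) (Metric.closedBall (0 : ℝ) 1) := fun r hr => by
  rw [mem_closedBall_zero_iff, Real.norm_of_nonneg (sq_nonneg r)]
  exact pow_le_one₀ hr.1 hr.2

theorem continuousOn_polylog_two_sq :
    ContinuousOn (fun r : ℝ => polylog 2 (r ^ 2)) (Icc 0 1) :=
  (continuousOn_polylog (𝕜 := ℝ) 0).comp (by fun_prop) mapsTo_sq_closedBall

theorem hasDerivAt_polylog_two_sq {r : ℝ} (hr : r ∈ Ioo (0 : ℝ) 1) :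
    HasDerivAt (fun r : ℝ => polylog 2 (r ^ 2)) (-2 * Real.log (1 - r ^ 2) / r) r := by
  have h : r ^ 2 ∈ Ioo (0 : ℝ) 1 := ⟨pow_pos hr.1 2, pow_lt_one₀ hr.1.le hr.2 two_ne_zero⟩
  have h0 := hr.1.ne'
  convert! HasDerivAt.comp (h₂ := polylog 2) (h := fun r : ℝ => r ^ 2) r
    (hasDerivAt_polylog_two h) (hasDerivAt_pow 2 r) using 1
  field_simp
  push_cast
  ring

theorem hasDerivAt_im {f : ℝ → ℂ} {f' : ℂ} {r : ℝ} (h : HasDerivAt f f' r) :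
    HasDerivAt (fun r => (f r).im) f'.im r :=
  Complex.imCLM.hasFDerivAt.comp_hasDerivAt r h

/-- Integration by parts, with arctan r written as Im log(1+ir). -/
theorem integral_polylog_two_sq :
    ∫ r in (0 : ℝ)..1, polylog 2 (r ^ 2) / (1 + r ^ 2)
      = polylog 2 1 * (Complex.log (1 + Complex.I)).im + 2 * (arctanLogPrimitive 1).im
        - 2 * (arctanLogPrimitive 0).im := by
  have hcl : ContinuousOn (fun r : ℝ => (Complex.log (1 + r * Complex.I)).im) (Icc 0 1) :=
    Complex.continuous_im.comp_continuousOn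
      (ContinuousOn.clog (by fun_prop) fun r _ => one_add_mul_I_mem r)
  have h := intervalIntegral.integral_eq_sub_of_hasDerivAt_of_le zero_le_one
    (f := fun r : ℝ => polylog 2 (r ^ 2) * (Complex.log (1 + r * Complex.I)).im
      + 2 * (arctanLogPrimitive r).im)
    (f' := fun r : ℝ => polylog 2 (r ^ 2) / (1 + r ^ 2))
    ((continuousOn_polylog_two_sq.mul hcl).add (continuousOn_const.mul
      (Complex.continuous_im.comp_continuousOn continuousOn_arctanLogPrimitive)))
    (fun r hr => ?_) (ContinuousOn.intervalIntegrable ?_)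
  · rw [h]
    simp [polylog_zero]
  · have d1 := hasDerivAt_im ((hasDerivAt_one_add_mul_I r).clog_real (one_add_mul_I_mem r))
    have d2 := hasDerivAt_im (hasDerivAt_arctanLogPrimitive hr)
    convert! ((hasDerivAt_polylog_two_sq hr).mul d1).add (d2.const_mul 2) using 1
    have e1 : (Complex.I / (1 + r * Complex.I)).im = 1 / (1 + r ^ 2) := by
      simp [Complex.div_im, Complex.normSq_apply]
      ring
    have e2 : ((Complex.log (1 + r * Complex.I) * Real.log (1 - r ^ 2)
        - Real.log (1 - r) ^ 2 / 2 - Real.log (1 + r) ^ 2 / 2) / r).im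
        = (Complex.log (1 + r * Complex.I)).im * Real.log (1 - r ^ 2) / r := by
      rw [Complex.div_ofReal_im, Complex.sub_im, Complex.sub_im, Complex.im_mul_ofReal]
      norm_cast
      simp only [sub_zero]
    rw [e1, e2]
    have := hr.1.ne'
    field_simp
    ring
  · rw [uIcc_of_le zero_le_one]
    exact continuousOn_polylog_two_sq.div (by fun_prop) fun r _ => by positivity

/-! ### Special values of polylogarithms -/

theorem polylog_conj (k : ℕ) (z : ℂ) : polylog k (conj z) = conj (polylog k z) := by
  rw [polylog, polylog, Complex.conj_tsum]
  refine tsum_congr fun n => ?_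
  simp

theorem polylog_two_one : polylog 2 (1 : ℝ) = π ^ 2 / 6 := by
  rw [← zetaReal_two, zetaReal_eq_tsum 0, polylog]
  simp

theorem I_pow_eq (n : ℕ) :
    Complex.I ^ n = (Real.cos (π * n / 2) : ℂ) + (Real.sin (π * n / 2) : ℂ) * Complex.I := by
  have h : Complex.exp (π / 2 * Complex.I) = Complex.I := by
    rw [Complex.exp_mul_I, Complex.cos_pi_div_two, Complex.sin_pi_div_two, zero_add, one_mul]
  rw [Complex.ofReal_cos, Complex.ofReal_sin, ← Complex.exp_mul_I]
  nth_rw 1 [← h]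
  rw [← Complex.exp_nat_mul]
  congr 1
  push_cast
  ring

theorem hasSum_polylog_I (k : ℕ) :
    HasSum (fun n : ℕ => Complex.I ^ (n + 1) / ((n : ℂ) + 1) ^ (k + 2))
      (polylog (k + 2) Complex.I) :=
  (summable_polylog k (by simp)).hasSum

theorem polylog_I_term_im (k n : ℕ) : (Complex.I ^ (n + 1) / ((n : ℂ) + 1) ^ k).im
    = 1 / ((n + 1 : ℕ) : ℝ) ^ k * Real.sin (π * (n + 1 : ℕ) / 2) := by
  have e : ((n : ℂ) + 1) ^ k = (((n + 1 : ℕ) : ℝ) ^ k : ℝ) := by push_cast; rfl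
  rw [e, Complex.div_ofReal_im, I_pow_eq, Complex.add_im, Complex.ofReal_im, Complex.im_ofReal_mul]
  simp
  ring

theorem polylog_I_term_re (k n : ℕ) : (Complex.I ^ (n + 1) / ((n : ℂ) + 1) ^ k).re
    = 1 / ((n + 1 : ℕ) : ℝ) ^ k * Real.cos (π * (n + 1 : ℕ) / 2) := by
  have e : ((n : ℂ) + 1) ^ k = (((n + 1 : ℕ) : ℝ) ^ k : ℝ) := by push_cast; rfl
  rw [e, Complex.div_ofReal_re, I_pow_eq, Complex.add_re, Complex.ofReal_re, Complex.re_ofReal_mul]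
  simp
  ring

theorem polylog_three_I_im : (polylog 3 Complex.I).im = π ^ 3 / 32 := by
  have h := Complex.hasSum_im (hasSum_polylog_I 1)
  simp only [polylog_I_term_im] at h
  have h2 := (hasSum_nat_add_iff' (f := fun n : ℕ => (1 : ℝ) / (n : ℝ) ^ 3 * Real.sin (π * n / 2))
    1).2 hasSum_L_function_mod_four_eval_three
  have h3 := h.unique h2
  rw [h3]
  simp

theorem polylog_two_I_re : (polylog 2 Complex.I).re = -π ^ 2 / 48 := by
  have h := Complex.hasSum_re (hasSum_polylog_I 0)
  simp only [polylog_I_term_re] at h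
  have h1 := hasSum_one_div_nat_pow_mul_cos one_ne_zero (x := 1 / 4) ⟨by norm_num, by norm_num⟩
  have h2 := (hasSum_nat_add_iff' 1).2 h1
  -- The Fourier series of the Bernoulli polynomial B₂ at 1/4 gives ∑ cos(πn/2)/n², and B₂(1/4) =
  -- 1/16 - 1/4 + 1/6.
  have e : (Polynomial.map (algebraMap ℚ ℝ) (Polynomial.bernoulli (2 * 1))).eval (1 / 4)
      = -1 / 48 := by
    have : (1 / 4 : ℝ) = (algebraMap ℚ ℝ) (1 / 4 : ℚ) := by simp
    rw [this, Polynomial.eval_map, Polynomial.eval₂_at_apply, Polynomial.bernoulli_def]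
    simp [Finset.sum_range_succ, bernoulli_one, bernoulli_two]
    norm_num
  rw [e] at h2
  have h4 : (fun n : ℕ => 1 / ((n + 1 : ℕ) : ℝ) ^ (0 + 2) * Real.cos (π * (n + 1 : ℕ) / 2))
      = fun n : ℕ => 1 / ((n + 1 : ℕ) : ℝ) ^ (2 * 1) * Real.cos (2 * π * (n + 1 : ℕ) * (1 / 4)) := by
    funext n
    congr 2
    ring
  rw [h4] at h
  have h3 := h.unique h2
  rw [h3]
  simp
  ring

theorem I_pow_even_im (n : ℕ) : (Complex.I ^ (2 * n + 1 + 1)).im = 0 := by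
  have e : (-1 : ℂ) ^ (n + 1) = (((-1) ^ (n + 1) : ℝ) : ℂ) := by push_cast; rfl
  rw [show 2 * n + 1 + 1 = 2 * (n + 1) by ring, pow_mul, Complex.I_sq, e, Complex.ofReal_im]

theorem I_pow_odd_im (n : ℕ) : (Complex.I ^ (2 * n + 1)).im = (-1) ^ n := by
  have e : (-1 : ℂ) ^ n = (((-1) ^ n : ℝ) : ℂ) := by push_cast; rfl
  rw [pow_succ, pow_mul, Complex.I_sq, e, Complex.im_ofReal_mul, Complex.I_im, mul_one]

theorem polylog_two_I_im : (polylog 2 Complex.I).im = catalanConstant := by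
  have hs : (fun n : ℕ => (Complex.I ^ (n + 1) / ((n : ℂ) + 1) ^ (0 + 2)).im)
      = fun n : ℕ => (Complex.I ^ (n + 1)).im / ((n : ℝ) + 1) ^ 2 := by
    funext n
    have e : ((n : ℂ) + 1) ^ (0 + 2) = (((n : ℝ) + 1) ^ 2 : ℝ) := by push_cast; rfl
    rw [e, Complex.div_ofReal_im]
  have h : HasSum (fun n : ℕ => (Complex.I ^ (n + 1)).im / ((n : ℝ) + 1) ^ 2)
      (polylog 2 Complex.I).im := by
    rw [← hs]
    exact Complex.hasSum_im (hasSum_polylog_I 0)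
  have he : HasSum (fun n : ℕ => (Complex.I ^ (2 * n + 1)).im / (((2 * n : ℕ) : ℝ) + 1) ^ 2)
      catalanConstant := by
    have hinj : Function.Injective fun n : ℕ => 2 * n := fun a b h => by simpa using h
    have hs2 := (h.summable.comp_injective hinj).hasSum
    convert! hs2 using 1
    rw [catalanConstant]
    refine tsum_congr fun n => ?_
    simp only [Function.comp_apply, I_pow_odd_im]
    push_cast
    ring
  have ho : HasSum (fun n : ℕ => (Complex.I ^ (2 * n + 1 + 1)).im
      / (((2 * n + 1 : ℕ) : ℝ) + 1) ^ 2) 0 := by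
    simp only [I_pow_even_im, zero_div]
    exact hasSum_zero
  have h2 := HasSum.even_add_odd (f := fun n : ℕ => (Complex.I ^ (n + 1)).im / ((n : ℝ) + 1) ^ 2)
    he ho
  rw [add_zero] at h2
  exact h.unique h2

theorem half_one_add_I : ((1 : ℂ) + Complex.I) / 2 = 1 - (1 + Complex.I)⁻¹ := by
  have h : (1 : ℂ) + Complex.I ≠ 0 := by simpa using one_add_mul_I_ne_zero 1
  field_simp
  linear_combination Complex.I_sq

/-- Landen's identity Li₂(w/(1+w)) = -Li₂(-w) - ½ log²(1+w) along w = it: the difference of the two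
sides has zero derivative for 0 < t < 1 and vanishes at t = 0. The value t = 1 is reached by
continuity on the closed disc. -/
theorem polylog_two_landen : polylog 2 ((1 + Complex.I) / 2)
    = -polylog 2 (-Complex.I) - 1 / 2 * Complex.log (1 + Complex.I) ^ 2 := by
  have hc : ContinuousOn (fun t : ℝ => polylog 2 (1 - (1 + t * Complex.I)⁻¹)
      + polylog 2 (-(t * Complex.I)) + 1 / 2 * Complex.log (1 + t * Complex.I) ^ 2) (Icc 0 1) := by
    have hc0 : ContinuousOn (fun r : ℝ => 1 + (r : ℂ) * Complex.I) (Icc 0 1) := by fun_prop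
    have hp := continuousOn_polylog (𝕜 := ℂ) 0
    refine ContinuousOn.add (ContinuousOn.add (hp.comp (continuousOn_const.sub
      (hc0.inv₀ fun r _ => one_add_mul_I_ne_zero r)) fun r hr => ?_)
      (hp.comp (by fun_prop) fun r hr => ?_))
      (continuousOn_const.mul ((hc0.clog fun r _ => one_add_mul_I_mem r).pow 2))
    · have h0 := one_add_mul_I_ne_zero r
      have e : 1 - (1 + (r : ℂ) * Complex.I)⁻¹ = r * Complex.I * (1 + r * Complex.I)⁻¹ := by
        field_simp
        ring
      rw [mem_closedBall_zero_iff, e, norm_mul, norm_mul, Complex.norm_I, mul_one,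
        Complex.norm_real, Real.norm_of_nonneg hr.1]
      exact mul_le_one₀ hr.2 (norm_nonneg _) (norm_inv_one_add_mul_I_le r)
    · rw [mem_closedBall_zero_iff, norm_neg, norm_mul, Complex.norm_I, mul_one,
        Complex.norm_real, Real.norm_of_nonneg hr.1]
      exact hr.2
  have h := intervalIntegral.integral_eq_sub_of_hasDerivAt_of_le zero_le_one hc
    (f' := fun _ => 0) (fun t ht => ?_) (by simp)
  · simp only [intervalIntegral.integral_zero, Complex.ofReal_one, one_mul, Complex.ofReal_zero,
      zero_mul, neg_zero, add_zero, inv_one, sub_self, polylog_zero, Complex.log_one,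
      ← half_one_add_I] at h
    linear_combination -h
  · have h0 := one_add_mul_I_ne_zero t
    have ht0 : (t : ℂ) ≠ 0 := by exact_mod_cast ht.1.ne'
    have hI0 := Complex.I_ne_zero
    have e : 1 - (1 + (t : ℂ) * Complex.I)⁻¹ = t * Complex.I * (1 + t * Complex.I)⁻¹ := by
      field_simp
      ring
    have n1 : ‖1 - (1 + (t : ℂ) * Complex.I)⁻¹‖ < 1 := by
      rw [e, norm_mul, norm_mul, Complex.norm_I, mul_one, Complex.norm_real,
        Real.norm_of_nonneg ht.1.le]
      exact mul_lt_one_of_nonneg_of_lt_one_left ht.1.le ht.2 (norm_inv_one_add_mul_I_le t)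
    have n2 : ‖-((t : ℂ) * Complex.I)‖ < 1 := by
      rw [norm_neg, norm_mul, Complex.norm_I, mul_one, Complex.norm_real,
        Real.norm_of_nonneg ht.1.le]
      exact ht.2
    have hd := hasDerivAt_one_add_mul_I t
    have hd2 : HasDerivAt (fun t : ℝ => -((t : ℂ) * Complex.I)) (-Complex.I) t := by
      simpa using (hd.const_sub 1)
    have n0 : 1 - (1 + (t : ℂ) * Complex.I)⁻¹ ≠ 0 := by
      rw [e]
      exact mul_ne_zero (mul_ne_zero ht0 hI0) (inv_ne_zero h0)
    have d1 := (hasDerivAt_polylog 1 n1 n0).comp t ((hd.inv h0).const_sub 1)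
    have d2 := (hasDerivAt_polylog 1 n2 (neg_ne_zero.2 (mul_ne_zero ht0 hI0))).comp t hd2
    have d3 := ((hd.clog_real (one_add_mul_I_mem t)).pow 2).const_mul (1 / 2)
    convert! (d1.add d2).add d3 using 1
    rw [polylog_one_complex n1, polylog_one_complex n2, sub_sub_cancel, sub_neg_eq_add,
      log_inv_one_add_mul_I, e]
    field_simp
    ring

theorem log_one_add_I : Complex.log (1 + Complex.I)
    = ((Real.log 2 / 2 : ℝ) : ℂ) + ((π / 4 : ℝ) : ℂ) * Complex.I := by
  have h : (1 : ℂ) + Complex.I = ((√2 : ℝ) : ℂ) * Complex.exp ((π / 4 : ℝ) * Complex.I) := by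
    rw [Complex.exp_mul_I, ← Complex.ofReal_cos, ← Complex.ofReal_sin, Real.cos_pi_div_four,
      Real.sin_pi_div_four, mul_add, ← mul_assoc, ← Complex.ofReal_mul]
    have : √2 * (√2 / 2) = 1 := by
      rw [← mul_div_assoc, Real.mul_self_sqrt zero_le_two]
      norm_num
    rw [this]
    simp
  rw [h, Complex.log_ofReal_mul (by positivity) (Complex.exp_ne_zero _), Complex.log_exp,
    Real.log_sqrt zero_le_two]
  · simp
    linarith [Real.pi_pos]
  · simp
    linarith [Real.pi_pos]

/-! ### Endpoint values of the primitive -/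

theorem arctanLogPrimitive_zero_im : (arctanLogPrimitive 0).im = π ^ 3 / 16 := by
  have h : arctanLogPrimitive 0 = -2 * conj (polylog 3 Complex.I) := by
    rw [← polylog_conj, Complex.conj_I]
    simp [arctanLogPrimitive, pathA, pathB, logSqPrimitive]
    ring
  rw [h]
  simp [polylog_three_I_im]
  ring

/-- With z = (1+i)/2, the points 1/(1+i), 1 - z and -iz all equal the conjugate of z, so only Li₂
and Li₃ at z occur. Landen's identity then trades Li₂(z) for Li₂(i), whose imaginary part is
Catalan's constant. -/
theorem arctanLogPrimitive_one_im : (arctanLogPrimitive 1).im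
    = -π ^ 3 / 16 + 4 * (polylog 3 ((1 + Complex.I) / 2)).im
      + 2 * catalanConstant * Real.log 2 - π / 8 * Real.log 2 ^ 2 := by
  set z : ℂ := (1 + Complex.I) / 2 with hz
  have c2 : conj (2 : ℂ) = 2 := map_ofNat _ 2
  have hcz : conj z = (1 - Complex.I) / 2 := by
    rw [hz, map_div₀, map_add, map_one, Complex.conj_I, c2, sub_eq_add_neg]
  have hzi : (1 + Complex.I)⁻¹ = conj z := by
    rw [hcz, ← sub_sub_cancel 1 (1 + Complex.I)⁻¹, ← half_one_add_I]
    ring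
  have hz1 : 1 - conj z = z := by
    rw [hcz, hz]
    ring
  have hz2 : 1 - z = conj z := by
    rw [hcz, hz]
    ring
  have hIz : -Complex.I * z = conj z := by
    rw [hcz, hz]
    linear_combination (-1 / 2 : ℂ) * Complex.I_sq
  have hpB : pathB 1 = z := by
    rw [pathB, hz]
    push_cast
    ring
  have hpA : pathA 1 = 0 := by simp [pathA]
  have hlz : Complex.log z = Complex.log (1 + Complex.I) - Real.log 2 := by
    rw [← hpB, log_pathB zero_le_one]
    norm_num
  have hlz' : Complex.log (conj z) = -Complex.log (1 + Complex.I) := by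
    have := log_inv_one_add_mul_I 1
    rwa [Complex.ofReal_one, one_mul, hzi] at this
  have hL2 := polylog_two_landen
  rw [← hz, ← Complex.conj_I, polylog_conj] at hL2
  have h0 : ∀ u, logSqPrimitive u 0 = 0 := fun u => by simp [logSqPrimitive, polylog_zero]
  rw [arctanLogPrimitive, hpA, hpB, h0, h0, Complex.ofReal_one, one_mul, hzi]
  simp only [logSqPrimitive, one_mul, hIz, hz1, hz2, hlz, hlz', polylog_conj, hL2, log_one_add_I]
  rw [← Complex.re_add_im (polylog 2 Complex.I), ← Complex.re_add_im (polylog 3 z),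
    polylog_two_I_re, polylog_two_I_im]
  -- Turning the real constants into atoms, with log 2 = 2m, makes the imaginary part a polynomial
  -- identity.
  generalize hl : Real.log 2 = l
  generalize hp : -π ^ 2 / 48 = p
  generalize hq : π / 4 = q
  have hl2 : l = 2 * (l / 2) := by ring
  generalize l / 2 = m at hl2 ⊢
  subst hl2
  simp [pow_succ, c2]
  rw [← hp, show π = 4 * q by rw [← hq]; ring]
  ring

/-! ### Assembly of the closed forms -/

theorem integral_polylog_two_sq_eq :
    ∫ r in (0 : ℝ)..1, polylog 2 (r ^ 2) / (1 + r ^ 2)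
      = -5 * π ^ 3 / 24 + 8 * (trilog ((1 + Complex.I) / 2)).im
        + 4 * catalanConstant * Real.log 2 - π / 4 * Real.log 2 ^ 2 := by
  rw [integral_polylog_two_sq, polylog_two_one, arctanLogPrimitive_zero_im,
    arctanLogPrimitive_one_im, log_one_add_I, trilog_eq_polylog, Complex.add_im,
    Complex.ofReal_im, Complex.im_ofReal_mul, Complex.I_im]
  ring

theorem tsum_harmonic_div_cube_eq :
    π / 2 * (∑' n : ℕ, (harmonic (n + 1) : ℝ) / ((n : ℝ) + 1) ^ 3 * centralSq n) =
      64 - 10 * π ^ 3 / 3 + 128 * (trilog ((1 + Complex.I) / 2)).im - 96 * Real.log 2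
        + 64 * catalanConstant * Real.log 2 - 4 * π * Real.log 2 ^ 2 := by
  rw [tsum_harmonic_div_cube, tsum_harmonic_div_eq_integral, tsum_harmonic_succ_div,
    integral_polylog_two_sq_eq]
  have := Real.pi_pos
  field_simp
  ring

theorem integral_trilog_mul_ellipticK_eq :
    (∫ x in (0 : ℝ)..1, trilog x * ellipticK x) =
      2 * zetaReal 3 + π ^ 3 / 3 - 4 * π ^ 2 / 3
        + π / 2 * ∑' n : ℕ, (harmonic (n + 1) : ℝ) / ((n : ℝ) + 1) ^ 3 * centralSq n := by
  have hs : Summable fun n : ℕ =>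
      (harmonic (n + 1) : ℝ) / ((n : ℝ) + 1) ^ 3 * centralSq n := summable_centralSq_harmonic_pow 2
  have h := ((((hasSum_centralSq_div.mul_left (zetaReal 3)).sub
    (hasSum_centralSq_div_sq.mul_left (zetaReal 2))).add hs.hasSum)).mul_left (π / 2)
  have e := hasSum_integral_trilog_mul_ellipticK.unique (h.congr_fun fun n => by ring)
  rw [e, zetaReal_two]
  have := Real.pi_pos
  field_simp
  ring

end EllipticTrilog

theorem mainTheorem11 :
    IntervalIntegrable (fun x : ℝ => trilog x * ellipticK x) MeasureTheory.volume 0 1 ∧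
    Summable (fun n : ℕ =>
      (zetaReal 3 / ((n : ℝ) + 1) - zetaReal 2 / ((n : ℝ) + 1) ^ 2
        + (harmonic (n + 1) : ℝ) / ((n : ℝ) + 1) ^ 3) * centralSq n) ∧
    Summable (fun n : ℕ => (harmonic (n + 1) : ℝ) / ((n : ℝ) + 1) ^ 3 * centralSq n) ∧
    (∫ x in (0 : ℝ)..1, trilog x * ellipticK x) =
      π / 2 * ∑' n : ℕ,
        (zetaReal 3 / ((n : ℝ) + 1) - zetaReal 2 / ((n : ℝ) + 1) ^ 2
          + (harmonic (n + 1) : ℝ) / ((n : ℝ) + 1) ^ 3) * centralSq n ∧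
    (∫ x in (0 : ℝ)..1, trilog x * ellipticK x) =
      2 * zetaReal 3 + π ^ 3 / 3 - 4 * π ^ 2 / 3
        + π / 2 * ∑' n : ℕ, (harmonic (n + 1) : ℝ) / ((n : ℝ) + 1) ^ 3 * centralSq n ∧
    (∫ x in (0 : ℝ)..1, trilog x * ellipticK x) =
      64 - 4 * π ^ 2 / 3 - 96 * Real.log 2 + 2 * zetaReal 3 - 3 * π ^ 3
        + 64 * catalanConstant * Real.log 2 - 4 * π * Real.log 2 ^ 2
        + 128 * (trilog ((1 + Complex.I) / 2)).im ∧
    π / 2 * (∑' n : ℕ, (harmonic (n + 1) : ℝ) / ((n : ℝ) + 1) ^ 3 * centralSq n) =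
      64 - 10 * π ^ 3 / 3 + 128 * (trilog ((1 + Complex.I) / 2)).im - 96 * Real.log 2
        + 64 * catalanConstant * Real.log 2 - 4 * π * Real.log 2 ^ 2 := by
  refine ⟨EllipticTrilog.intervalIntegrable_trilog_mul_ellipticK,
    EllipticTrilog.summable_moment_mul_centralSq, EllipticTrilog.summable_centralSq_harmonic_pow 2,
    ?_, EllipticTrilog.integral_trilog_mul_ellipticK_eq, ?_,
    EllipticTrilog.tsum_harmonic_div_cube_eq⟩
  · rw [← EllipticTrilog.hasSum_integral_trilog_mul_ellipticK.tsum_eq, tsum_mul_left]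
  · rw [EllipticTrilog.integral_trilog_mul_ellipticK_eq, EllipticTrilog.tsum_harmonic_div_cube_eq]
    ring
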